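/- A finite PO-DTMC $M=(S,PI,PT,O_1,\dots,O_n,\pi)$ for $n$ agents consists of a finite set $S$ of states, an initial distribution $PI$ on $S$, a stochastic matrix $PT$ on $S$, an observation function $O_i$ on $S$ for each agent $i$, and a valuation $\pi(s)\subseteq \mathit{Prop}$ of a finite set $\mathit{Prop}$ of $k$ atomic propositions at each state $s$. As an input of an algorithm it is given by an explicit list of its data, with rational probabilities. An infinite path is a sequence $s_0s_1\dots$ of states with $PI(s_0)>0$ and $PT(s_j,s_{j+1})>0$ for all $j$; $\mu$ is the probability measure on infinite paths for which the paths with prefix $s_0\dots s_m$ have measure $PI(s_0)PT(s_0,s_1)\cdots PT(s_{m-1},s_m)$. Under the synchronous perfect recall semantics, the local state of agent $i$ at time $m$ on a path $\rho$ is the sequence $O_i(\rho(0))\dots O_i(\rho(m))$, and the value of $\mathrm{Pr}_i(p)$ at $(\rho,m)$ is the conditional probability under $\mu$ of the paths $\rho'$ with $p\in\pi(\rho'(m))$, given that agent $i$ has the same local state at $(\rho',m)$ as at $(\rho,m)$. We write $M\models^{\mathtt{spr}} EF(\mathrm{Pr}_i(p)>c)$ if for every infinite path $\rho$ there are an infinite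 path $\rho'$ with $\rho'(0)=\rho(0)$ and a time $m\ge 0$ such that the value of $\mathrm{Pr}_i(p)$ at $(\rho',m)$ is greater than $c$. Theorem. For all $n,k\ge 1$, every agent $i\in\{1,\dots,n\}$, every atomic proposition $p$ among the $k$, and every rational constant $c$ with $0<c<1$, the following problem is undecidable: given a finite PO-DTMC $M$ with $n$ agents and $k$ atomic propositions, determine whether $M\models^{\mathtt{spr}} EF(\mathrm{Pr}_i(p)>c)$. -/

import Mathlib

namespace PerfectRecall

/-! ### Systems of runs with a common prior -/

/-- A run maps each time to a global state: an environment state (in `E`) together with a local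
state (in `L`) for each agent. -/
abbrev Run (Agt E L : Type) : Type := ℕ → E × (Agt → L)

/-- The data `(R, Pr, π)`: a set `R` of runs, a prior `Pr = (R, F, μ)` on it, and an interpretation
`π` of the atomic propositions at the points `(r, m)` of `R × ℕ`. -/
structure PriorSystem (Agt E L AP : Type) where
  runs : Set (Run Agt E L)
  events : MeasurableSpace runs
  prior : @MeasureTheory.Measure runs events
  val : runs × ℕ → Set AP

namespace PriorSystem

variable {Agt E L AP : Type}

/-- The points `(r, m)` of the system. -/
abbrev Point (I : PriorSystem Agt E L AP) : Type := I.runs × ℕ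

/-- The local state `r_i(m)` of agent `i` at the point `x = (r, m)`. -/
def localState (I : PriorSystem Agt E L AP) (i : Agt) (x : I.Point) : L :=
  (x.1.1 x.2).2 i

/-- `K_i(r, m)`: the points that agent `i` cannot distinguish from `(r, m)`. -/
def indist (I : PriorSystem Agt E L AP) (i : Agt) (x : I.Point) : Set I.Point :=
  {y | I.localState i y = I.localState i x}

/-- `R(U)`: the runs passing through some point of `U`. -/
def runsThrough (I : PriorSystem Agt E L AP) (U : Set I.Point) : Set I.runs :=
  {r | ∃ m, (r, m) ∈ U}

/-- `μ_{r,m,i}(U) = μ(R(U) | R(K_i(r, m)))`, for sets `U ⊆ K_i(r, m)` of points. -/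
noncomputable def agentProb (I : PriorSystem Agt E L AP) (i : Agt) (x : I.Point)
    (U : Set I.Point) : ℝ :=
  (I.prior (I.runsThrough U ∩ I.runsThrough (I.indist i x))).toReal
    / (I.prior (I.runsThrough (I.indist i x))).toReal

end PriorSystem

/-! ### The temporal, epistemic and probabilistic logic -/

/-- The comparison symbols of the logic. -/
inductive Cmp : Type
  | le | lt | eq | gt | ge

/-- The relation on the reals denoted by a comparison symbol. -/
def Cmp.Holds : Cmp → ℝ → ℝ → Prop
  | .le, x, y => x ≤ y
  | .lt, x, y => x < y
  | .eq, x, y => x = y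
  | .gt, x, y => x > y
  | .ge, x, y => x ≥ y

mutual
/-- Formulas
`φ ::= p | ¬φ | φ ∧ φ | A φ | X φ | φ U φ | K_i φ | f(P_1, …, P_k) ⋈ c`,
where `f` is a polynomial with rational coefficients and `c` is rational. -/
inductive Formula (Agt AP : Type) : Type
  | atom (p : AP) : Formula Agt AP
  | neg (φ : Formula Agt AP) : Formula Agt AP
  | conj (φ ψ : Formula Agt AP) : Formula Agt AP
  | all (φ : Formula Agt AP) : Formula Agt AP
  | next (φ : Formula Agt AP) : Formula Agt AP
  | untl (φ ψ : Formula Agt AP) : Formula Agt AP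
  | know (i : Agt) (φ : Formula Agt AP) : Formula Agt AP
  | cmp (k : ℕ) (f : MvPolynomial (Fin k) ℚ) (P : Fin k → ProbTerm Agt AP)
      (rel : Cmp) (c : ℚ) : Formula Agt AP

/-- Basic probability expressions `P ::= Pr_i(φ) | Prior_i(φ)`. -/
inductive ProbTerm (Agt AP : Type) : Type
  | pr (i : Agt) (φ : Formula Agt AP) : ProbTerm Agt AP
  | prior (i : Agt) (φ : Formula Agt AP) : ProbTerm Agt AP
end

namespace Formula

variable {Agt AP : Type}

/-- The constant `true`, expressed as the tautology `¬(φ ∧ ¬φ)`. -/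
def top (φ : Formula Agt AP) : Formula Agt AP := neg (conj φ (neg φ))

/-- `F φ = true U φ`. -/
def eventually (φ : Formula Agt AP) : Formula Agt AP := untl (top φ) φ

/-- `E φ = ¬A¬φ`. -/
def ex (φ : Formula Agt AP) : Formula Agt AP := neg (all (neg φ))

/-- `Pr_i(φ) > c`. -/
noncomputable def probGt (i : Agt) (φ : Formula Agt AP) (c : ℚ) : Formula Agt AP :=
  cmp 1 (MvPolynomial.X 0) (fun _ => ProbTerm.pr i φ) Cmp.gt c

end Formula

section Semantics

variable {Agt E L AP : Type}

mutual
/-- `I, (r, m) ⊨ φ`. -/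
noncomputable def Sat (I : PriorSystem Agt E L AP) : Formula Agt AP → I.Point → Prop
  | .atom p, x => p ∈ I.val x
  | .neg φ, x => ¬ Sat I φ x
  | .conj φ ψ, x => Sat I φ x ∧ Sat I ψ x
  | .all φ, x => ∀ r' : I.runs, (∀ l ≤ x.2, r'.1 l = x.1.1 l) → Sat I φ (r', x.2)
  | .next φ, x => Sat I φ (x.1, x.2 + 1)
  | .untl φ ψ, x =>
      ∃ k, x.2 ≤ k ∧ Sat I ψ (x.1, k) ∧ ∀ l, x.2 ≤ l → l < k → Sat I φ (x.1, l)
  | .know i φ, x => ∀ y ∈ I.indist i x, Sat I φ y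
  | .cmp _ f P rel c, x => rel.Holds (MvPolynomial.aeval (fun j => termVal I (P j) x) f) c

/-- The value of a basic probability expression at a point. -/
noncomputable def termVal (I : PriorSystem Agt E L AP) : ProbTerm Agt AP → I.Point → ℝ
  | .pr i φ, x => I.agentProb i x {y | y ∈ I.indist i x ∧ Sat I φ y}
  | .prior i φ, x => I.agentProb i (x.1, 0) {y | y ∈ I.indist i (x.1, 0) ∧ Sat I φ y}
end

end Semantics

/-! ### Partially observed Markov chains -/

/-- An interpreted partially observed discrete-time Markov chain with finite state set `S`. -/
structure PODTMC (Agt S Obs AP : Type) [Fintype S] where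
  init : S → ℝ
  trans : S → S → ℝ
  init_nonneg : ∀ s, 0 ≤ init s
  init_sum : ∑ s, init s = 1
  trans_nonneg : ∀ s t, 0 ≤ trans s t
  trans_sum : ∀ s, ∑ t, trans s t = 1
  obs : Agt → S → Obs
  val : S → Set AP

namespace PODTMC

variable {Agt S Obs AP : Type} [Fintype S]

/-- The infinite paths of `M`. -/
def IsPath (M : PODTMC Agt S Obs AP) (ρ : ℕ → S) : Prop :=
  M.init (ρ 0) ≠ 0 ∧ ∀ k, 0 < M.trans (ρ k) (ρ (k + 1))

/-- The type of infinite paths of `M`. -/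
abbrev Path (M : PODTMC Agt S Obs AP) : Type := {ρ : ℕ → S // M.IsPath ρ}

/-- The initial distribution. -/
noncomputable def initPMF (M : PODTMC Agt S Obs AP) : PMF S :=
  PMF.ofFintype (fun s => ENNReal.ofReal (M.init s)) (by
    rw [← ENNReal.ofReal_sum_of_nonneg (fun s _ => M.init_nonneg s), M.init_sum,
      ENNReal.ofReal_one])

/-- The distribution of the successor of the state `s`. -/
noncomputable def stepPMF (M : PODTMC Agt S Obs AP) (s : S) : PMF S :=
  PMF.ofFintype (fun t => ENNReal.ofReal (M.trans s t)) (by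
    rw [← ENNReal.ofReal_sum_of_nonneg (fun t _ => M.trans_nonneg s t), M.trans_sum,
      ENNReal.ofReal_one])

variable [MeasurableSpace S] [DiscreteMeasurableSpace S]

/-- The transition kernel of the chain. -/
noncomputable def stepKernel (M : PODTMC Agt S Obs AP) : ProbabilityTheory.Kernel S S :=
  ProbabilityTheory.Kernel.ofFunOfCountable (fun s => (M.stepPMF s).toMeasure)

instance (M : PODTMC Agt S Obs AP) : ProbabilityTheory.IsMarkovKernel M.stepKernel :=
  ⟨fun s => PMF.toMeasure.isProbabilityMeasure (M.stepPMF s)⟩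

/-- The next-state kernel given the history up to time `n`: it uses only the state at time `n`. -/
noncomputable def histKernel (M : PODTMC Agt S Obs AP) (n : ℕ) :
    ProbabilityTheory.Kernel (Finset.Iic n → S) S :=
  M.stepKernel.comap (fun h => h ⟨n, Finset.mem_Iic.2 le_rfl⟩) (measurable_pi_apply _)

instance (M : PODTMC Agt S Obs AP) (n : ℕ) :
    ProbabilityTheory.IsMarkovKernel (M.histKernel n) := by
  unfold histKernel; infer_instance

/-- The law of the chain on all sequences of states: the set of the sequences with prefix
`s_0 … s_m` has measure `PI(s_0) · PT(s_0, s_1) ⋯ PT(s_{m-1}, s_m)`. -/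
noncomputable def seqMeasure (M : PODTMC Agt S Obs AP) : MeasureTheory.Measure (ℕ → S) :=
  ProbabilityTheory.Kernel.trajMeasure (X := fun _ => S) M.initPMF.toMeasure M.histKernel

/-- The probability measure of `Pr(M)` on the infinite paths of `M`. (The sequences that are not
paths form a measurable set of measure zero.) -/
noncomputable def pathMeasure (M : PODTMC Agt S Obs AP) : MeasureTheory.Measure M.Path :=
  M.seqMeasure.comap Subtype.val

/-- The run `ρ^spr` of a path `ρ`: the local state of agent `i` at time `m` is the sequence
`O_i(ρ(0)) … O_i(ρ(m))` of all its observations so far. -/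
def sprRun (M : PODTMC Agt S Obs AP) (ρ : ℕ → S) : Run Agt S (List Obs) :=
  fun m => (ρ m, fun i => List.ofFn fun j : Fin (m + 1) => M.obs i (ρ j))

/-- The set `R^spr(M)` of the runs `ρ^spr`, for `ρ` an infinite path of `M`. -/
def sprRuns (M : PODTMC Agt S Obs AP) : Set (Run Agt S (List Obs)) :=
  Set.range fun ρ : M.Path => M.sprRun ρ.1

/-- The bijection `ρ ↦ ρ^spr` from paths to runs. -/
def toSprRuns (M : PODTMC Agt S Obs AP) (ρ : M.Path) : M.sprRuns :=
  ⟨M.sprRun ρ.1, Set.mem_range_self ρ⟩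

/-- The system `I^spr(M)`. Events and prior are transported from paths to runs along `ρ ↦ ρ^spr`. -/
noncomputable def sprSystem (M : PODTMC Agt S Obs AP) : PriorSystem Agt S (List Obs) AP where
  runs := M.sprRuns
  events := MeasurableSpace.map M.toSprRuns inferInstance
  prior := @MeasureTheory.Measure.map _ _ _ (MeasurableSpace.map M.toSprRuns inferInstance)
    M.toSprRuns M.pathMeasure
  val := fun x => M.val (x.1.1 x.2).1

/-- `M ⊨^spr φ`: the formula `φ` holds at time `0` of all runs of `I^spr(M)`. -/
def SprModels (M : PODTMC Agt S Obs AP) (φ : Formula Agt AP) : Prop :=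
  ∀ r : M.sprSystem.runs, Sat M.sprSystem φ (r, 0)

end PODTMC

/-! ### Finite presentations as inputs of algorithms -/

/-- A finite PO-DTMC with `n` agents and `k` atomic propositions given by finite data: the states
are numbered `0, …, size - 1`, the probabilities are rational, and observations are named by
natural numbers. -/
structure FinitePODTMC (n k : ℕ) where
  size : ℕ
  init : Fin size → ℚ
  trans : Fin size → Fin size → ℚ
  init_nonneg : ∀ s, 0 ≤ init s
  init_sum : ∑ s, init s = 1
  trans_nonneg : ∀ s t, 0 ≤ trans s t
  trans_sum : ∀ s, ∑ t, trans s t = 1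
  obs : Fin n → Fin size → ℕ
  val : Fin size → Fin k → Bool

namespace FinitePODTMC

variable {n k : ℕ}

/-- The PO-DTMC given by the finite data. -/
def toPODTMC (M : FinitePODTMC n k) : PODTMC (Fin n) (Fin M.size) ℕ (Fin k) where
  init s := (M.init s : ℝ)
  trans s t := (M.trans s t : ℝ)
  init_nonneg s := by exact_mod_cast M.init_nonneg s
  init_sum := by exact_mod_cast M.init_sum
  trans_nonneg s t := by exact_mod_cast M.trans_nonneg s t
  trans_sum s := by exact_mod_cast M.trans_sum s
  obs := M.obs
  val s := {p | M.val s p = true}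

/-- Codes of finite PO-DTMCs: number of states, initial probabilities, matrix of transition
probabilities, observations of each agent, valuation. -/
abbrev Code : Type :=
  ℕ × List (ℕ × ℕ) × List (List (ℕ × ℕ)) × List (List ℕ) × List (List Bool)

/-- A nonnegative rational as the pair of its numerator and denominator in lowest terms. -/
def ratCode (q : ℚ) : ℕ × ℕ := (q.num.toNat, q.den)

/-- The code of a finite PO-DTMC: all its data, listed explicitly. -/
def encode (M : FinitePODTMC n k) : Code :=
  (M.size,
    List.ofFn fun s => ratCode (M.init s),
    List.ofFn fun s => List.ofFn fun t => ratCode (M.trans s t),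
    List.ofFn fun i => List.ofFn fun s => M.obs i s,
    List.ofFn fun s => List.ofFn fun p => M.val s p)

theorem ratCode_inj {q r : ℚ} (hq : 0 ≤ q) (hr : 0 ≤ r) (h : ratCode q = ratCode r) : q = r := by
  obtain ⟨h1, h2⟩ := Prod.ext_iff.1 h
  have hq' := Rat.num_nonneg.2 hq
  have hr' := Rat.num_nonneg.2 hr
  refine Rat.ext ?_ h2
  simp only [ratCode] at h1
  omega

/-- Distinct presentations have distinct codes. -/
theorem encode_injective : Function.Injective (encode : FinitePODTMC n k → Code) := by
  rintro ⟨m, PI, PT, hPI, hPI1, hPT, hPT1, O, V⟩ ⟨m', PI', PT', hPI', hPI1', hPT', hPT1', O', V'⟩ h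
  simp only [encode, Prod.mk.injEq] at h
  obtain ⟨rfl, h1, h2, h3, h4⟩ := h
  have e1 : PI = PI' := funext fun s =>
    ratCode_inj (hPI s) (hPI' s) (congrFun (List.ofFn_injective h1) s)
  have e2 : PT = PT' := funext fun s => funext fun t =>
    ratCode_inj (hPT s t) (hPT' s t)
      (congrFun (List.ofFn_injective (congrFun (List.ofFn_injective h2) s)) t)
  have e3 : O = O' := funext fun i => List.ofFn_injective (congrFun (List.ofFn_injective h3) i)
  have e4 : V = V' := funext fun s => List.ofFn_injective (congrFun (List.ofFn_injective h4) s)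
  subst e1 e2 e3 e4
  rfl

end FinitePODTMC

/-- A property of finite PO-DTMCs is decidable if some computable predicate on codes agrees with it
on the codes of all finite PO-DTMCs. -/
def DecidableProperty {n k : ℕ} (Q : FinitePODTMC n k → Prop) : Prop :=
  ∃ D : FinitePODTMC.Code → Prop, ComputablePred D ∧ ∀ M, D M.encode ↔ Q M

end PerfectRecall

-- The halting problem is reduced to the stated one. Nondeterministic programs over registers
-- (increment, clear, equality test, iteration) evaluate all partial recursive functions: a loop
-- guesses how often to iterate, and a later test discards wrong guesses (`exists_prog_of_partrec`).
-- The instruction words that a program may execute form a regular language, so halting on `n` means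
-- that some word accepted by a fixed finite automaton executes without a failed test
-- (`Prog.exists_dfa`).
--
-- Failure is detected by linear algebra over the natural numbers. On the products of two entries
-- among the registers and the constant 1, every instruction acts linearly. A test of x = y adds x²
-- + y² to one accumulator and 2xy to another. Their difference, a sum of squares (x - y)², is a
-- natural number that is less than 1 exactly when all tests succeed. Combined with the automaton,
-- this gives matrices, a starting vector u(n) and weights a, b such that the computation on `n`
-- halts iff some product v of u(n) with matrices satisfies v·b < v·a (`exists_matrices`).
--
-- A Markov chain picks a coordinate with probability proportional to u(n) and then moves by the
-- matrices, all scaled by one bound; missing mass goes to an absorbing state. Observations reveal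
-- which matrix was used but not the coordinate, so the joint probabilities of an observed word and
-- the current coordinate form a multiple of v. Two final states with the same observation are
-- entered with weights c·a and (1 - c)·b, and only the first satisfies p. With A = v·a and B = v·b,
-- the posterior of p is cA/(cA + (1 - c)B), which exceeds c iff B < A
-- (`Threshold.sprModels_chain_iff`). The input changes only the transition row of the initial
-- state, whose entries are 0 or n^e/(n+1)², so the reduction is computable
-- (`Threshold.primrec_encode_chain`).

-- Nondeterministic register programs evaluate partial recursive functions

namespace RegisterProgram

/-- Instructions on natural-valued registers: increment, clear, and test of equality. -/
inductive Instr (ι : Type) : Type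
  | inc (i : ι)
  | clr (i : ι)
  | eq (i j : ι)

namespace Instr

/-- The effect of an instruction on the registers. -/
def act : Instr ℕ → (ℕ → ℕ) → ℕ → ℕ
  | inc i, x => Function.update x i (x i + 1)
  | clr i, x => Function.update x i 0
  | eq _ _, x => x

/-- The instruction does not fail. -/
def Ok : Instr ℕ → (ℕ → ℕ) → Prop
  | inc _, _ => True
  | clr _, _ => True
  | eq i j, x => x i = x j

end Instr

/-- Programs with nondeterministic iteration. -/
inductive Prog : Type
  | instr (l : Instr ℕ)
  | seq (P Q : Prog)
  | star (P : Prog)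

/-- The input-output relation of a program. -/
def Prog.Rel : Prog → (ℕ → ℕ) → (ℕ → ℕ) → Prop
  | .instr l, x, y => l.Ok x ∧ l.act x = y
  | .seq P Q, x, z => ∃ y, P.Rel x y ∧ Q.Rel y z
  | .star P, x, y => Relation.ReflTransGen P.Rel x y

namespace Prog

theorem rel_instr {l : Instr ℕ} {x y : ℕ → ℕ} : (instr l).Rel x y ↔ l.Ok x ∧ l.act x = y := Iff.rfl

theorem rel_seq {P Q : Prog} {x z : ℕ → ℕ} :
    (seq P Q).Rel x z ↔ ∃ y, P.Rel x y ∧ Q.Rel y z := Iff.rfl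

theorem rel_star {P : Prog} {x y : ℕ → ℕ} :
    (star P).Rel x y ↔ Relation.ReflTransGen P.Rel x y := Iff.rfl

theorem rel_inc {i : ℕ} {x y : ℕ → ℕ} :
    (instr (.inc i)).Rel x y ↔ Function.update x i (x i + 1) = y := by
  simp [rel_instr, Instr.Ok, Instr.act]

theorem rel_clr {i : ℕ} {x y : ℕ → ℕ} :
    (instr (.clr i)).Rel x y ↔ Function.update x i 0 = y := by
  simp [rel_instr, Instr.Ok, Instr.act]

theorem rel_eq {i j : ℕ} {x y : ℕ → ℕ} :
    (instr (.eq i j)).Rel x y ↔ x i = x j ∧ x = y := Iff.rfl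

theorem rel_star_inc {i : ℕ} {x y : ℕ → ℕ} :
    (star (instr (.inc i))).Rel x y ↔ ∃ k, y = Function.update x i (x i + k) := by
  rw [rel_star]
  constructor
  · intro h
    induction h with
    | refl => exact ⟨0, by simp⟩
    | tail _ h ih =>
      obtain ⟨k, rfl⟩ := ih
      rw [rel_inc] at h
      exact ⟨k + 1, by rw [← h]; simp [add_assoc]⟩
  · rintro ⟨k, rfl⟩
    induction k with
    | zero => simpa using Relation.ReflTransGen.refl
    | succ k ih =>
      refine ih.tail ?_
      rw [rel_inc]
      simp [add_assoc]

theorem star_invariant {P : Prog} {p : (ℕ → ℕ) → Prop}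
    (hp : ∀ y z, p y → P.Rel y z → p z) {x y : ℕ → ℕ} (hxy : (star P).Rel x y) (hx : p x) : p y := by
  rw [rel_star] at hxy
  induction hxy with
  | refl => exact hx
  | tail _ h ih => exact hp _ _ ih h

/-- Copy register `i` to register `j`. -/
def copy (i j : ℕ) : Prog :=
  seq (instr (.clr j)) (seq (star (instr (.inc j))) (instr (.eq i j)))

/-- The loop guesses a value for register `j`, and only the correct guess survives the equality
test, so the relation is a function. -/
theorem rel_copy {i j : ℕ} (h : i ≠ j) {x y : ℕ → ℕ} :
    (copy i j).Rel x y ↔ y = Function.update x j (x i) := by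
  simp only [copy, rel_seq, rel_clr, rel_star_inc, rel_eq]
  constructor
  · rintro ⟨_, rfl, _, ⟨k, rfl⟩, h1, rfl⟩
    simp [h] at h1
    simp [h1]
  · rintro rfl
    exact ⟨_, rfl, _, ⟨x i, rfl⟩, by simp [h], by simp⟩

/-- Test that register `i` is zero, using the scratch register `j`. -/
def isZero (i j : ℕ) : Prog := seq (instr (.clr j)) (instr (.eq i j))

theorem rel_isZero {i j : ℕ} (h : i ≠ j) {x y : ℕ → ℕ} :
    (isZero i j).Rel x y ↔ x i = 0 ∧ y = Function.update x j 0 := by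
  simp only [isZero, rel_seq, rel_clr, rel_eq]
  constructor
  · rintro ⟨_, rfl, h1, rfl⟩
    simpa [h] using h1
  · rintro ⟨h1, rfl⟩
    exact ⟨_, rfl, by simp [h, h1], rfl⟩

/-- Test that register `i` is positive, using the scratch register `j`. -/
def isPos (i j : ℕ) : Prog :=
  seq (instr (.clr j)) (seq (instr (.inc j)) (seq (star (instr (.inc j))) (instr (.eq i j))))

theorem rel_isPos {i j : ℕ} (h : i ≠ j) {x y : ℕ → ℕ} :
    (isPos i j).Rel x y ↔ x i ≠ 0 ∧ y = Function.update x j (x i) := by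
  simp only [isPos, rel_seq, rel_clr, rel_eq, rel_inc, rel_star_inc]
  constructor
  · rintro ⟨_, rfl, _, rfl, _, ⟨k, rfl⟩, h1, rfl⟩
    simp [h] at h1
    simp [h1]
  · rintro ⟨h1, rfl⟩
    obtain ⟨k, hk⟩ := Nat.exists_eq_succ_of_ne_zero h1
    exact ⟨_, rfl, _, rfl, _, ⟨k, rfl⟩, by simp [h, hk]; omega, by simp [hk]; congr 1; omega⟩

end Prog

open Prog

/-- `F` can be evaluated by a program that reads its arguments from given registers below a bound
`b`, leaves all registers below `b` unchanged and writes the result to register `b`. -/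
def Programmable {n : ℕ} (F : List.Vector ℕ n →. ℕ) : Prop :=
  ∀ (b : ℕ) (a : Fin n → ℕ), (∀ i, a i < b) → ∃ P : Prog, ∀ x : ℕ → ℕ,
    (∀ y, P.Rel x y → (∀ r < b, y r = x r) ∧ y b ∈ F (List.Vector.ofFn fun i => x (a i))) ∧
    ∀ m ∈ F (List.Vector.ofFn fun i => x (a i)), ∃ y, P.Rel x y ∧ y b = m

theorem mem_mOfFn {α : Type} : ∀ {n : ℕ} {g : Fin n → Part α} {v : List.Vector α n},
    v ∈ List.Vector.mOfFn g ↔ ∀ i, v.get i ∈ g i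
  | 0, g, v => by
    simp [List.Vector.mOfFn, List.Vector.eq_nil v]
  | n + 1, g, v => by
    simp only [List.Vector.mOfFn, Part.bind_eq_bind, Part.mem_bind_iff, Part.pure_eq_some,
      Part.mem_some_iff, mem_mOfFn, Fin.forall_fin_succ]
    constructor
    · rintro ⟨a, ha, w, hw, rfl⟩
      simpa using ⟨ha, hw⟩
    · rintro ⟨h0, h1⟩
      exact ⟨v.head, by simpa using h0, v.tail, by simpa using h1, by simp⟩

/-- The functions are evaluated in turn, the one with index `j` with bound `b + j`, which protects
both the arguments and the earlier results. -/
theorem programmable_family {m b : ℕ} {a : Fin m → ℕ} (ha : ∀ i, a i < b) :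
    ∀ {n : ℕ} (g : Fin n → (List.Vector ℕ m →. ℕ)), (∀ j, Programmable (g j)) →
    ∃ P : Prog, ∀ x : ℕ → ℕ,
      (∀ y, P.Rel x y → (∀ r < b, y r = x r) ∧
        ∀ j : Fin n, y (b + j) ∈ g j (List.Vector.ofFn fun i => x (a i))) ∧
      ∀ v : Fin n → ℕ, (∀ j, v j ∈ g j (List.Vector.ofFn fun i => x (a i))) →
        ∃ y, P.Rel x y ∧ ∀ j : Fin n, y (b + j) = v j
  | 0, g, _ => by
    refine ⟨instr (.eq 0 0), fun x => ⟨?_, ?_⟩⟩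
    · rintro y ⟨-, rfl⟩
      exact ⟨fun _ _ => rfl, fun j => j.elim0⟩
    · exact fun v _ => ⟨x, ⟨rfl, rfl⟩, fun j => j.elim0⟩
  | n + 1, g, hg => by
    obtain ⟨P, hP⟩ := programmable_family ha (fun j : Fin n => g j.castSucc) fun j => hg _
    obtain ⟨Q, hQ⟩ := hg (Fin.last n) (b + n) a fun i => (ha i).trans_le (by omega)
    have key : ∀ x y : ℕ → ℕ, (∀ r < b, y r = x r) →
        (List.Vector.ofFn fun i => y (a i)) = List.Vector.ofFn fun i => x (a i) := by
      intro x y h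
      congr 1
      funext i
      exact h _ (ha i)
    refine ⟨seq P Q, fun x => ⟨?_, ?_⟩⟩
    · rintro z ⟨y, h1, h2⟩
      obtain ⟨h3, h4⟩ := (hP x).1 y h1
      obtain ⟨h5, h6⟩ := (hQ y).1 z h2
      rw [key x y h3] at h6
      refine ⟨fun r hr => (h5 r (by omega)).trans (h3 r hr), fun j => ?_⟩
      refine Fin.lastCases ?_ (fun j => ?_) j
      · simpa using h6
      · have := h4 j
        rw [← h5 (b + j) (by have := j.2; omega)] at this
        simpa using this
    · intro v hv
      obtain ⟨y, h1, h2⟩ := (hP x).2 (fun j => v j.castSucc) fun j => hv _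
      have h3 := (hP x).1 y h1
      obtain ⟨z, h4, h5⟩ := (hQ y).2 (v (Fin.last n)) (by rw [key x y h3.1]; exact hv _)
      have h6 := (hQ y).1 z h4
      refine ⟨z, ⟨y, h1, h4⟩, fun j => ?_⟩
      refine Fin.lastCases ?_ (fun j => ?_) j
      · simpa using h5
      · have := h2 j
        rw [← h6.1 (b + j) (by have := j.2; omega)] at this
        simpa using this

theorem Programmable.comp {m n : ℕ} {f : List.Vector ℕ n →. ℕ}
    {g : Fin n → (List.Vector ℕ m →. ℕ)} (hf : Programmable f) (hg : ∀ j, Programmable (g j)) :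
    Programmable fun v => (List.Vector.mOfFn fun j => g j v).bind f := by
  intro b a ha
  obtain ⟨P, hP⟩ := programmable_family ha g hg
  obtain ⟨Q, hQ⟩ := hf (b + n) (fun j => b + j) fun j => by omega
  -- The inner results occupy `b, …, b + n - 1`, and the outer one goes to `b + n`. For `n = 0` it
  -- is already in register `b`, and copying a register to itself would replace it by an arbitrary
  -- guess.
  refine ⟨seq P (seq Q (if n = 0 then instr (.eq 0 0) else copy (b + n) b)), fun x => ⟨?_, ?_⟩⟩
  · rintro z ⟨y, h1, y', h2, h3⟩
    obtain ⟨h4, h5⟩ := (hP x).1 y h1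
    obtain ⟨h6, h7⟩ := (hQ y).1 y' h2
    have h8 : (∀ r < b, z r = y' r) ∧ z b = y' (b + n) := by
      split_ifs at h3 with hn
      · obtain ⟨-, rfl⟩ := rel_eq.1 h3
        simp [hn]
      · rw [rel_copy (by omega)] at h3
        subst h3
        exact ⟨fun r hr => by simp [hr.ne], by simp⟩
    refine ⟨fun r hr => by rw [h8.1 r hr, h6 r (by omega), h4 r hr], ?_⟩
    exact Part.mem_bind_iff.2 ⟨List.Vector.ofFn fun j => y (b + j), mem_mOfFn.2 <| by simpa using h5, by rw [h8.2]; exact h7⟩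
  · intro k hk
    obtain ⟨v, hv, hk⟩ := Part.mem_bind_iff.1 hk
    obtain ⟨y, h1, h2⟩ := (hP x).2 v.get (mem_mOfFn.1 hv)
    obtain ⟨y', h3, h4⟩ := (hQ y).2 k (by simpa [h2] using hk)
    by_cases hn : n = 0
    · refine ⟨y', ⟨y, h1, y', h3, ?_⟩, by simpa [hn] using h4⟩
      rw [if_pos hn]
      exact ⟨rfl, rfl⟩
    · refine ⟨Function.update y' b (y' (b + n)), ⟨y, h1, y', h3, ?_⟩, ?_⟩
      · rw [if_neg hn, rel_copy (by omega)]
      · simpa using h4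

theorem Programmable.of_eq {n : ℕ} {f g : List.Vector ℕ n →. ℕ} (hf : Programmable f)
    (h : ∀ v, f v = g v) : Programmable g :=
  (funext h : f = g) ▸ hf

/-- A program for a total function. -/
theorem programmable_total {n : ℕ} {f : List.Vector ℕ n → ℕ} :
    Programmable (f : List.Vector ℕ n →. ℕ) ↔
    ∀ (b : ℕ) (a : Fin n → ℕ), (∀ i, a i < b) → ∃ P : Prog, ∀ x : ℕ → ℕ,
      (∀ y, P.Rel x y → (∀ r < b, y r = x r) ∧ y b = f (List.Vector.ofFn fun i => x (a i))) ∧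
      ∃ y, P.Rel x y := by
  unfold Programmable
  refine forall₃_congr fun b a ha => exists_congr fun P => forall_congr' fun x => ?_
  simp only [PFun.coe_val, Part.mem_some_iff, forall_eq]
  refine and_congr_right fun h => ⟨fun ⟨y, h1, _⟩ => ⟨y, h1⟩, fun ⟨y, h1⟩ => ⟨y, h1, (h y h1).2⟩⟩

/-- Register `b` holds the current value of the recursion, `b + 1` the counter, and `b + 2` the
newly computed value. The loop runs a guessed number of times, and the final test compares the
counter with the recursion argument. -/
theorem programmable_prec {n : ℕ} {f : List.Vector ℕ n → ℕ} {g : List.Vector ℕ (n + 2) → ℕ}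
    (hf : Programmable (f : List.Vector ℕ n →. ℕ))
    (hg : Programmable (g : List.Vector ℕ (n + 2) →. ℕ)) :
    Programmable ((fun v : List.Vector ℕ (n + 1) =>
      (v.head.rec (f v.tail) fun y IH => g (y ::ᵥ IH ::ᵥ v.tail) : ℕ) :
        List.Vector ℕ (n + 1) → ℕ) : List.Vector ℕ (n + 1) →. ℕ) := by
  rw [programmable_total] at *
  intro b a ha
  obtain ⟨P, hP⟩ := hf b (fun i => a i.succ) fun i => ha _
  obtain ⟨Q, hQ⟩ := hg (b + 2) (Fin.cons (b + 1) (Fin.cons b fun i => a i.succ)) (by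
    refine Fin.cases (by simp) (Fin.cases (by simp) fun i => ?_)
    have := ha i.succ
    simp; omega)
  let body : Prog := seq Q (seq (copy (b + 2) b) (instr (.inc (b + 1))))
  have vec : ∀ x y : ℕ → ℕ, (∀ r < b, y r = x r) →
      (List.Vector.ofFn fun i => y ((Fin.cons (b + 1) (Fin.cons b fun i => a i.succ) :
        Fin (n + 2) → ℕ) i)) =
      y (b + 1) ::ᵥ y b ::ᵥ List.Vector.ofFn fun i => x (a i.succ) := by
    intro x y h
    ext i
    refine Fin.cases ?_ (Fin.cases ?_ fun i => ?_) i
    · simp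
    · exact (List.Vector.get_ofFn _ _).trans rfl
    · simp [h _ (ha i.succ)]
  let val : (ℕ → ℕ) → ℕ → ℕ := fun x k =>
    Nat.rec (f (List.Vector.ofFn fun i => x (a i.succ)))
      (fun y IH => g (y ::ᵥ IH ::ᵥ List.Vector.ofFn fun i => x (a i.succ))) k
  let Inv : (ℕ → ℕ) → (ℕ → ℕ) → Prop := fun x y =>
    (∀ r < b, y r = x r) ∧ y b = val x (y (b + 1))
  have step : ∀ x y z, Inv x y → body.Rel y z → Inv x z ∧ z (b + 1) = y (b + 1) + 1 := by
    rintro x y z ⟨h1, h2⟩ ⟨u, h3, h4⟩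
    simp only [rel_seq, rel_copy (show b + 2 ≠ b by omega), rel_inc] at h4
    obtain ⟨_, rfl, rfl⟩ := h4
    obtain ⟨h5, h6⟩ := (hQ y).1 u h3
    rw [vec x y h1] at h6
    refine ⟨⟨fun r hr => ?_, ?_⟩, ?_⟩
    · rw [← h1 r hr, ← h5 r (by omega)]
      simp [hr.ne, (show r ≠ b + 1 by omega)]
    · simp [h6, h5 (b + 1) (by omega), h2, val]
    · simp [h5 (b + 1) (by omega)]
  have total : ∀ y, ∃ z, body.Rel y z := by
    intro y
    obtain ⟨u, hu⟩ := (hQ y).2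
    exact ⟨_, u, hu, _, (rel_copy (by omega)).2 rfl, rel_inc.2 rfl⟩
  have start : ∀ x y, P.Rel x y → Inv x (Function.update y (b + 1) 0) := by
    intro x y h
    obtain ⟨h1, h2⟩ := (hP x).1 y h
    refine ⟨fun r hr => ?_, ?_⟩
    · simp [(show r ≠ b + 1 by omega), h1 r hr]
    · simp [h2, val]
  refine ⟨seq P (seq (instr (.clr (b + 1))) (seq (star body) (instr (.eq (b + 1) (a 0))))),
    fun x => ⟨?_, ?_⟩⟩
  · rintro z ⟨y, h1, _, h2, w, h3, h4⟩
    rw [rel_clr] at h2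
    subst h2
    obtain rfl := (rel_eq.1 h4).2
    have h5 : Inv x w :=
      star_invariant (p := Inv x) (fun u v hu huv => (step x u v hu huv).1) h3 (start x y h1)
    refine ⟨h5.1, ?_⟩
    have h6 : w (b + 1) = x (a 0) := by
      rw [← h5.1 _ (ha 0)]
      exact (rel_eq.1 h4).1
    rw [h5.2, h6]
    simp [val]
  · obtain ⟨y, hy⟩ := (hP x).2
    have loop : ∀ k, ∃ z, (star body).Rel (Function.update y (b + 1) 0) z ∧ Inv x z ∧
        z (b + 1) = k := by
      intro k
      induction k with
      | zero => exact ⟨_, Relation.ReflTransGen.refl, start x y hy, by simp⟩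
      | succ k ih =>
        obtain ⟨z, h1, h2, h3⟩ := ih
        obtain ⟨z', hz'⟩ := total z
        have := step x z z' h2 hz'
        exact ⟨z', Relation.ReflTransGen.tail h1 hz', this.1, by rw [this.2, h3]⟩
    obtain ⟨z, h1, h2, h3⟩ := loop (x (a 0))
    refine ⟨z, y, hy, _, rel_clr.2 rfl, z, h1, ?_, rfl⟩
    rw [Instr.Ok, h3, h2.1 _ (ha 0)]

/-- Register `b` holds the candidate. A pass through the loop succeeds only if the value at the
candidate is positive, and the exit only if it is zero, so a completed run has found the least zero;
without a zero no run is completed. -/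
theorem programmable_rfind {n : ℕ} {f : List.Vector ℕ (n + 1) → ℕ}
    (hf : Programmable (f : List.Vector ℕ (n + 1) →. ℕ)) :
    Programmable fun v : List.Vector ℕ n =>
      Nat.rfind fun k => Part.some (decide (f (k ::ᵥ v) = 0)) := by
  rw [programmable_total] at hf
  intro b a ha
  obtain ⟨P, hP⟩ := hf (b + 1) (Fin.cons b a)
    (Fin.cases (by simp) fun i => by have := ha i; simp; omega)
  have vec : ∀ x y : ℕ → ℕ, (∀ r < b, y r = x r) →
      (List.Vector.ofFn fun i => y ((Fin.cons b a : Fin (n + 1) → ℕ) i)) =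
      y b ::ᵥ List.Vector.ofFn fun i => x (a i) := by
    intro x y h
    ext i
    refine Fin.cases ?_ (fun i => ?_) i
    · simp
    · simp [h _ (ha i)]
  let body : Prog := seq P (seq (isPos (b + 1) (b + 2)) (instr (.inc b)))
  let Inv : (ℕ → ℕ) → (ℕ → ℕ) → Prop := fun x y =>
    (∀ r < b, y r = x r) ∧ ∀ k < y b, f (k ::ᵥ List.Vector.ofFn fun i => x (a i)) ≠ 0
  have step : ∀ x y z, Inv x y → body.Rel y z → Inv x z := by
    rintro x y z ⟨h1, h2⟩ ⟨u, h3, h4⟩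
    simp only [rel_seq, rel_isPos (show b + 1 ≠ b + 2 by omega), rel_inc] at h4
    obtain ⟨_, ⟨h7, rfl⟩, rfl⟩ := h4
    obtain ⟨h5, h6⟩ := (hP y).1 u h3
    rw [vec x y h1] at h6
    refine ⟨fun r hr => ?_, fun k hk => ?_⟩
    · rw [← h1 r hr, ← h5 r (by omega)]
      simp [hr.ne, (show r ≠ b + 2 by omega)]
    · simp [h5 b (by omega)] at hk
      rcases hk.lt_or_eq with hk | rfl
      · exact h2 k hk
      · rwa [← h6]
  have start : ∀ x, Inv x (Function.update x b 0) := fun x =>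
    ⟨fun r hr => by simp [hr.ne], fun k hk => by simp at hk⟩
  have mem : ∀ (x : ℕ → ℕ) (k : ℕ),
      (k ∈ Nat.rfind fun k =>
        Part.some (decide (f (k ::ᵥ List.Vector.ofFn fun i => x (a i)) = 0))) ↔
      f (k ::ᵥ List.Vector.ofFn fun i => x (a i)) = 0 ∧
      ∀ j < k, f (j ::ᵥ List.Vector.ofFn fun i => x (a i)) ≠ 0 := by
    intro x k
    refine Nat.mem_rfind.trans ?_
    simp [Part.mem_some_iff, eq_comm]
  refine ⟨seq (instr (.clr b)) (seq (star body) (seq P (isZero (b + 1) (b + 2)))),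
    fun x => ⟨?_, ?_⟩⟩
  · rintro z ⟨_, h2, w, h3, u, h4, h5⟩
    rw [rel_clr] at h2
    subst h2
    rw [rel_isZero (by omega)] at h5
    obtain ⟨h5, rfl⟩ := h5
    have h6 : Inv x w := star_invariant (p := Inv x) (step x) h3 (start x)
    obtain ⟨h7, h8⟩ := (hP w).1 u h4
    rw [vec x w h6.1] at h8
    refine ⟨fun r hr => ?_, ?_⟩
    · rw [← h6.1 r hr, ← h7 r (by omega)]
      simp [(show r ≠ b + 2 by omega)]
    · have : Function.update u (b + 2) 0 b = w b := by
        rw [← h7 b (by omega)]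
        simp
      rw [this, mem, ← h8]
      exact ⟨h5, h6.2⟩
  · intro m hm
    rw [mem] at hm
    have loop : ∀ k ≤ m, ∃ z, (star body).Rel (Function.update x b 0) z ∧ Inv x z ∧
        z b = k := by
      intro k
      induction k with
      | zero => exact fun _ => ⟨_, Relation.ReflTransGen.refl, start x, by simp⟩
      | succ k ih =>
        intro hk
        obtain ⟨z, h1, h2, h3⟩ := ih (by omega)
        obtain ⟨u, hu⟩ := (hP z).2
        obtain ⟨h4, h5⟩ := (hP z).1 u hu
        rw [vec x z h2.1] at h5
        have hz : body.Rel z _ := ⟨u, hu, _, (rel_isPos (by omega)).2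
          ⟨by rw [h5, h3]; exact hm.2 k (by omega), rfl⟩, rel_inc.2 rfl⟩
        refine ⟨_, Relation.ReflTransGen.tail h1 hz, step x z _ h2 hz, ?_⟩
        simp [h4 b (by omega), h3]
    obtain ⟨z, h1, h2, h3⟩ := loop m le_rfl
    obtain ⟨u, hu⟩ := (hP z).2
    obtain ⟨h4, h5⟩ := (hP z).1 u hu
    rw [vec x z h2.1] at h5
    refine ⟨_, ⟨_, rel_clr.2 rfl, z, h1, u, hu, (rel_isZero (by omega)).2 ⟨?_, rfl⟩⟩, ?_⟩
    · rw [h5, h3]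
      exact hm.1
    · simp [h4 b (by omega), h3]

theorem programmable_of_primrec' {n : ℕ} {f : List.Vector ℕ n → ℕ} (hf : Nat.Primrec' f) :
    Programmable (f : List.Vector ℕ n →. ℕ) := by
  induction hf with
  | zero =>
    rw [programmable_total]
    intro b a ha
    refine ⟨instr (.clr b), fun x => ⟨fun y h => ?_, _, rel_clr.2 rfl⟩⟩
    rw [rel_clr] at h
    subst h
    exact ⟨fun r hr => by simp [hr.ne], by simp⟩
  | succ =>
    rw [programmable_total]
    intro b a ha
    have h0 := (ha 0).ne
    refine ⟨seq (copy (a 0) b) (instr (.inc b)),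
      fun x => ⟨?_, _, _, (rel_copy h0).2 rfl, rel_inc.2 rfl⟩⟩
    rintro y ⟨z, h1, h2⟩
    rw [rel_copy h0] at h1
    rw [rel_inc] at h2
    subst h1 h2
    exact ⟨fun r hr => by simp [hr.ne], by simp⟩
  | get i =>
    rw [programmable_total]
    intro b a ha
    have h0 := (ha i).ne
    refine ⟨copy (a i) b, fun x => ⟨fun y h => ?_, _, (rel_copy h0).2 rfl⟩⟩
    rw [rel_copy h0] at h
    subst h
    exact ⟨fun r hr => by simp [hr.ne], by simp⟩
  | comp g _ _ ihf ihg =>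
    refine (ihf.comp ihg).of_eq fun v => ?_
    simp only [PFun.coe_val, Vector.mOfFn_part_some]
    exact Part.bind_some _ _
  | prec _ _ ihf ihg => exact programmable_prec ihf ihg

theorem programmable_of_partrec' {n : ℕ} {f : List.Vector ℕ n →. ℕ} (hf : Nat.Partrec' f) :
    Programmable f := by
  induction hf with
  | prim h => exact programmable_of_primrec' h
  | comp g _ _ ihf ihg => exact ihf.comp ihg
  | rfind _ ih => exact programmable_rfind ih

/-- The domain of a partial recursive function is decided by the runs of a program. -/
theorem exists_prog_of_partrec {f : ℕ →. ℕ} (hf : Partrec f) :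
    ∃ P : Prog, ∀ n, (∃ y, P.Rel (fun r => if r = 0 then n else 0) y) ↔ (f n).Dom := by
  -- The input is read from register `0` and the output is written to register `1`.
  obtain ⟨P, hP⟩ := programmable_of_partrec' (Nat.Partrec'.part_iff₁.2 hf) 1 (fun _ => 0)
    (fun _ => Nat.zero_lt_one)
  refine ⟨P, fun n => ?_⟩
  obtain ⟨h1, h2⟩ := hP fun r => if r = 0 then n else 0
  simp only [if_true, List.Vector.ofFn, List.Vector.head_cons] at h1 h2
  constructor
  · rintro ⟨y, hy⟩
    exact Part.dom_iff_mem.2 ⟨_, (h1 y hy).2⟩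
  · intro h
    obtain ⟨y, hy, _⟩ := h2 _ (Part.get_mem h)
    exact ⟨y, hy⟩

end RegisterProgram

-- Instruction words of programs as regular languages

namespace RegisterProgram

section Regular

variable {α : Type} {L M : Language α}

/-- By Myhill–Nerode: the quotient of `L * M` by `w` is the quotient of `L` by `w` times `M`,
together with the quotients of `M` by those `v` with `w = u ++ v` and `u ∈ L`. It is thus determined
by one quotient of `L` and a set of quotients of `M`, for which there are finitely many choices. -/
theorem isRegular_mul (hL : L.IsRegular) (hM : M.IsRegular) : (L * M).IsRegular := by
  refine Language.IsRegular.of_finite_range_leftQuotient ?_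
  let F : Language α × Set (Language α) → Language α :=
    fun p => {z | z ∈ p.1 * M ∨ ∃ B ∈ p.2, z ∈ B}
  refine (((hL.finite_range_leftQuotient).prod
    (hM.finite_range_leftQuotient).finite_subsets).image F).subset ?_
  rintro _ ⟨w, rfl⟩
  refine ⟨(L.leftQuotient w, {B | ∃ u v, u ++ v = w ∧ u ∈ L ∧ M.leftQuotient v = B}),
    ⟨⟨w, rfl⟩, ?_⟩, ?_⟩
  · rintro B ⟨u, v, -, -, rfl⟩
    exact ⟨v, rfl⟩
  · ext z
    rw [Language.mem_leftQuotient]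
    change (z ∈ L.leftQuotient w * M ∨
      ∃ B ∈ {B | ∃ u v, u ++ v = w ∧ u ∈ L ∧ M.leftQuotient v = B}, z ∈ B) ↔ _
    constructor
    · rintro (h | ⟨_, ⟨u, v, rfl, hu, rfl⟩, hz⟩)
      · obtain ⟨a, ha, b, hb, rfl⟩ := Language.mem_mul.1 h
        rw [← List.append_assoc]
        exact Language.append_mem_mul ha hb
      · rw [List.append_assoc]
        exact Language.append_mem_mul hu hz
    · intro h
      obtain ⟨a, ha, b, hb, hab⟩ := Language.mem_mul.1 h
      rcases List.append_eq_append_iff.1 hab with ⟨c, rfl, rfl⟩ | ⟨c, rfl, rfl⟩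
      · exact Or.inr ⟨_, ⟨a, c, rfl, ha, rfl⟩, hb⟩
      · exact Or.inl (Language.append_mem_mul ha hb)

/-- Here `v` is the part of `w` in the factor that contains the last letter of `w`. For empty `w`
there is no such factor, and the equivalence can fail at `z = []`. -/
theorem append_mem_kstar {w z : List α} (hw : w ≠ []) : w ++ z ∈ KStar.kstar L ↔
    ∃ u v, u ++ v = w ∧ u ∈ KStar.kstar L ∧ z ∈ L.leftQuotient v * KStar.kstar L := by
  constructor
  · intro h
    obtain ⟨S, hS, hSL⟩ := Language.mem_kstar.1 h
    clear h
    induction S generalizing w with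
    | nil => simp [hw] at hS
    | cons p S ih =>
      simp only [List.flatten_cons] at hS
      have hp := hSL p (by simp)
      have hSL' : ∀ y ∈ S, y ∈ L := fun y hy => hSL y (by simp [hy])
      rcases List.append_eq_append_iff.1 hS with ⟨c, rfl, rfl⟩ | ⟨c, rfl, hc⟩
      · exact ⟨[], w, rfl, Language.nil_mem_kstar L,
          Language.append_mem_mul hp (Language.join_mem_kstar hSL')⟩
      · by_cases hc0 : c = []
        · subst hc0
          refine ⟨[], p, by simp, Language.nil_mem_kstar L, ?_⟩
          rw [← List.nil_append z]
          refine Language.append_mem_mul (by simpa using hp) ?_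
          simp only [List.nil_append] at hc
          exact hc ▸ Language.join_mem_kstar hSL'
        · obtain ⟨u, v, rfl, hu, hz⟩ := ih hc0 hc.symm hSL'
          obtain ⟨U, rfl, hU⟩ := Language.mem_kstar.1 hu
          refine ⟨p ++ U.flatten, v, by simp, ?_, hz⟩
          exact Language.mem_kstar.2 ⟨p :: U, by simp, by simpa using ⟨hp, hU⟩⟩
  · rintro ⟨u, v, rfl, hu, hz⟩
    obtain ⟨U, rfl, hU⟩ := Language.mem_kstar.1 hu
    obtain ⟨a, ha, b, hb, rfl⟩ := Language.mem_mul.1 hz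
    obtain ⟨B, rfl, hB⟩ := Language.mem_kstar.1 hb
    refine Language.mem_kstar.2 ⟨U ++ (v ++ a) :: B, by simp, ?_⟩
    intro y hy
    simp only [List.mem_append, List.mem_cons] at hy
    rcases hy with hy | rfl | hy
    · exact hU y hy
    · exact ha
    · exact hB y hy

/-- A quotient by a nonempty word is determined by a set of quotients of `L`, by `append_mem_kstar`;
the empty word contributes the star itself. -/
theorem isRegular_kstar (hL : L.IsRegular) : (KStar.kstar L).IsRegular := by
  refine Language.IsRegular.of_finite_range_leftQuotient ?_
  let F : Set (Language α) → Language α := fun T => {z | ∃ B ∈ T, z ∈ B * KStar.kstar L}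
  refine (((hL.finite_range_leftQuotient).finite_subsets.image F).insert
    (KStar.kstar L)).subset ?_
  rintro _ ⟨w, rfl⟩
  by_cases hw : w = []
  · left
    simp [hw]
  right
  refine ⟨{B | ∃ u v, u ++ v = w ∧ u ∈ KStar.kstar L ∧ L.leftQuotient v = B}, ?_, ?_⟩
  · rintro B ⟨u, v, -, -, rfl⟩
    exact ⟨v, rfl⟩
  · ext z
    rw [Language.mem_leftQuotient, append_mem_kstar hw]
    change (∃ B ∈ {B | ∃ u v, u ++ v = w ∧ u ∈ KStar.kstar L ∧ L.leftQuotient v = B},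
      z ∈ B * KStar.kstar L) ↔ _
    constructor
    · rintro ⟨_, ⟨u, v, h1, h2, rfl⟩, hz⟩
      exact ⟨u, v, h1, h2, hz⟩
    · rintro ⟨u, v, h1, h2, hz⟩
      exact ⟨_, ⟨u, v, h1, h2, rfl⟩, hz⟩

theorem isRegular_singleton (l : α) : ({[l]} : Language α).IsRegular := by
  refine Language.IsRegular.of_finite_range_leftQuotient ?_
  refine (((Set.finite_singleton (0 : Language α)).insert ({[]} : Language α)).insert
    ({[l]} : Language α)).subset ?_
  rintro _ ⟨w, rfl⟩
  rcases w with _ | ⟨a, _ | ⟨b, w⟩⟩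
  · left
    rfl
  · by_cases h : a = l
    · right; left
      ext z
      rw [Language.mem_leftQuotient]
      change [a] ++ z = [l] ↔ z = []
      simp [h]
    · right; right
      ext z
      rw [Language.mem_leftQuotient]
      change [a] ++ z = [l] ↔ False
      simp [h]
  · right; right
    ext z
    rw [Language.mem_leftQuotient]
    change a :: b :: w ++ z = [l] ↔ False
    simp

end Regular

namespace Instr

/-- Rename the registers of an instruction. -/
def map {ι κ : Type} (f : ι → κ) : Instr ι → Instr κ
  | inc i => inc (f i)
  | clr i => clr (f i)
  | eq i j => eq (f i) (f j)

theorem exists_mem_range_map (l : Instr ℕ) :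
    ∃ N, ∀ K, N ≤ K → l ∈ Set.range (map (Fin.val : Fin K → ℕ)) := by
  cases l with
  | inc i => exact ⟨i + 1, fun K hK => ⟨inc ⟨i, hK⟩, rfl⟩⟩
  | clr i => exact ⟨i + 1, fun K hK => ⟨clr ⟨i, hK⟩, rfl⟩⟩
  | eq i j => exact ⟨max i j + 1, fun K hK => ⟨eq ⟨i, by omega⟩ ⟨j, by omega⟩, rfl⟩⟩

/-- Instructions as a sum type. -/
def toSum {ι : Type} : Instr ι → ι ⊕ ι ⊕ ι × ι
  | inc i => .inl i
  | clr i => .inr (.inl i)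
  | eq i j => .inr (.inr (i, j))

theorem toSum_injective {ι : Type} : Function.Injective (toSum (ι := ι)) := by
  rintro (i | i | ⟨i, j⟩) (k | k | ⟨k, l⟩) h <;> simp_all [toSum]

noncomputable instance {N : ℕ} : Fintype (Instr (Fin N)) := Fintype.ofInjective _ toSum_injective

end Instr

/-- The word `w` of instructions executes without failure, from `x` to `y`. -/
def Exec : List (Instr ℕ) → (ℕ → ℕ) → (ℕ → ℕ) → Prop
  | [], x, y => x = y
  | l :: w, x, y => l.Ok x ∧ Exec w (l.act x) y

theorem exec_append {v w : List (Instr ℕ)} {x z : ℕ → ℕ} :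
    Exec (v ++ w) x z ↔ ∃ y, Exec v x y ∧ Exec w y z := by
  induction v generalizing x with
  | nil => simp [Exec]
  | cons l v ih => simp [Exec, ih, and_assoc]

namespace Prog

/-- The words of instructions that a program may execute. -/
def lang : Prog → Language (Instr ℕ)
  | instr l => {[l]}
  | seq P Q => P.lang * Q.lang
  | star P => KStar.kstar P.lang

theorem isRegular_lang : ∀ P : Prog, P.lang.IsRegular
  | instr l => isRegular_singleton l
  | seq P Q => isRegular_mul P.isRegular_lang Q.isRegular_lang
  | star P => isRegular_kstar P.isRegular_lang

/-- A program mentions finitely many registers; this makes the alphabet and the dimension of the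
matrices finite. -/
theorem exists_bound (P : Prog) : ∃ N, ∀ K, N ≤ K → ∀ w ∈ P.lang, ∀ l ∈ w,
    l ∈ Set.range (Instr.map (Fin.val : Fin K → ℕ)) := by
  induction P with
  | instr l =>
    obtain ⟨N, hN⟩ := l.exists_mem_range_map
    refine ⟨N, fun K hK w hw l' hl' => ?_⟩
    obtain rfl : w = [l] := hw
    obtain rfl : l' = l := by simpa using hl'
    exact hN K hK
  | seq P Q ihP ihQ =>
    obtain ⟨N, hN⟩ := ihP
    obtain ⟨N', hN'⟩ := ihQ
    refine ⟨max N N', fun K hK w hw l hl => ?_⟩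
    obtain ⟨a, ha, b, hb, rfl⟩ := Language.mem_mul.1 hw
    rcases List.mem_append.1 hl with hl | hl
    · exact hN K (by omega) a ha l hl
    · exact hN' K (by omega) b hb l hl
  | star P ih =>
    obtain ⟨N, hN⟩ := ih
    refine ⟨N, fun K hK w hw l hl => ?_⟩
    obtain ⟨S, rfl, hS⟩ := Language.mem_kstar.1 hw
    obtain ⟨v, hv, hl⟩ := List.mem_flatten.1 hl
    exact hN K hK v (hS v hv) l hl

theorem rel_iff_exec {P : Prog} {x y : ℕ → ℕ} : P.Rel x y ↔ ∃ w ∈ P.lang, Exec w x y := by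
  induction P generalizing x y with
  | instr l =>
    rw [rel_instr]
    constructor
    · exact fun h => ⟨[l], rfl, h⟩
    · rintro ⟨w, hw, h⟩
      obtain rfl : w = [l] := hw
      exact h
  | seq P Q ihP ihQ =>
    simp only [rel_seq, ihP, ihQ]
    constructor
    · rintro ⟨z, ⟨v, hv, hv'⟩, w, hw, hw'⟩
      exact ⟨v ++ w, Language.append_mem_mul hv hw, exec_append.2 ⟨z, hv', hw'⟩⟩
    · rintro ⟨_, h, h'⟩
      obtain ⟨v, hv, w, hw, rfl⟩ := Language.mem_mul.1 h
      obtain ⟨z, hv', hw'⟩ := exec_append.1 h'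
      exact ⟨z, ⟨v, hv, hv'⟩, w, hw, hw'⟩
  | star P ih =>
    rw [rel_star]
    constructor
    · intro h
      induction h with
      | refl => exact ⟨[], Language.nil_mem_kstar _, rfl⟩
      | tail _ h ih' =>
        obtain ⟨v, hv, hv'⟩ := ih'
        obtain ⟨w, hw, hw'⟩ := ih.1 h
        obtain ⟨S, rfl, hS⟩ := Language.mem_kstar.1 hv
        refine ⟨S.flatten ++ w, Language.mem_kstar.2 ⟨S ++ [w], by simp, ?_⟩,
          exec_append.2 ⟨_, hv', hw'⟩⟩
        intro y hy
        rcases List.mem_append.1 hy with hy | hy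
        · exact hS y hy
        · rwa [List.mem_singleton.1 hy]
    · rintro ⟨_, h, h'⟩
      obtain ⟨S, rfl, hS⟩ := Language.mem_kstar.1 h
      clear h
      induction S generalizing x with
      | nil =>
        obtain rfl : x = y := h'
        exact .refl
      | cons v S ihS =>
        rw [List.flatten_cons, exec_append] at h'
        obtain ⟨z, h1, h2⟩ := h'
        exact .head (ih.2 ⟨v, hS v (by simp), h1⟩) (ihS (fun y hy => hS y (by simp [hy])) h2)

/-- The runs of a program are the executions of words accepted by a finite automaton. -/
theorem exists_dfa (P : Prog) : ∃ (N : ℕ) (σ : Type) (_ : Fintype σ)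
    (M : DFA (Instr (Fin N)) σ), 0 < N ∧ ∀ x, (∃ y, P.Rel x y) ↔
      ∃ w ∈ M.accepts, ∃ y, Exec (w.map (Instr.map Fin.val)) x y := by
  obtain ⟨N, hN⟩ := P.exists_bound
  obtain ⟨σ, hσ, M, hM⟩ := P.isRegular_lang
  -- The extra register ensures that the input register `0` is among those represented.
  refine ⟨N + 1, σ, hσ, M.comap (Instr.map Fin.val), N.succ_pos, fun x => ?_⟩
  simp only [rel_iff_exec, DFA.accepts_comap, hM]
  constructor
  · rintro ⟨y, w, hw, hy⟩
    have : w ∈ Set.range (List.map (Instr.map (Fin.val : Fin (N + 1) → ℕ))) := by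
      rw [Set.range_list_map]
      exact hN (N + 1) N.le_succ w hw
    obtain ⟨w, rfl⟩ := this
    exact ⟨w, hw, y, hy⟩
  · rintro ⟨w, hw, y, hy⟩
    exact ⟨y, _, hw, hy⟩

end Prog

end RegisterProgram

namespace RegisterProgram

/-! ### Executions as products of matrices

The coordinates are the products of two of the registers and the constant `1`, and two
accumulators; the difference of the accumulators is the sum of the squares of the differences of
the registers that were tested for equality. -/

/-- The value of a register, or of the constant `1`. -/
def ext {N : ℕ} (x : ℕ → ℕ) : Option (Fin N) → ℕ
  | none => 1
  | some i => x i

/-- The index type of the products of two registers and of the accumulators. -/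
abbrev Mono (N : ℕ) : Type := (Option (Fin N) × Option (Fin N)) ⊕ Bool

/-- The values of all coordinates. -/
def coords {N : ℕ} (x : ℕ → ℕ) (e : Bool → ℕ) : Mono N → ℕ
  | .inl p => ext x p.1 * ext x p.2
  | .inr b => e b

/-- The matrix of the linear action of an instruction on registers and the constant `1`. -/
def Instr.matrix {N : ℕ} : Instr (Fin N) → Option (Fin N) → Option (Fin N) → ℕ
  | inc i, s, t => (if s = t then 1 else 0) + (if s = none then if t = some i then 1 else 0 else 0)
  | clr i, s, t => if s = t then if t = some i then 0 else 1 else 0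
  | eq _ _, s, t => if s = t then 1 else 0

/-- The coefficients of the quadratic form that an instruction adds to an accumulator. -/
def Instr.form {N : ℕ} : Instr (Fin N) → Bool → Option (Fin N) × Option (Fin N) → ℕ
  | eq i j, true, p =>
    (if p = (some i, some i) then 1 else 0) + (if p = (some j, some j) then 1 else 0)
  | eq i j, false, p =>
    (if p = (some i, some j) then 1 else 0) + (if p = (some j, some i) then 1 else 0)
  | _, _, _ => 0

/-- The increment of the accumulators caused by an instruction. -/
def Instr.penalty : Instr ℕ → (ℕ → ℕ) → Bool → ℕ
  | eq i j, x, true => x i * x i + x j * x j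
  | eq i j, x, false => x i * x j + x j * x i
  | _, _, _ => 0

/-- The matrix of the action of an instruction on all coordinates. -/
def Instr.monoMatrix {N : ℕ} (l : Instr (Fin N)) : Mono N → Mono N → ℕ
  | .inl p, .inl q => l.matrix p.1 q.1 * l.matrix p.2 q.2
  | .inl p, .inr b => l.form b p
  | .inr b, .inr b' => if b = b' then 1 else 0
  | .inr _, .inl _ => 0

/-- Instructions are affine in the registers, and the constant coordinate makes them linear. -/
theorem sum_ext_mul_matrix {N : ℕ} (l : Instr (Fin N)) (x : ℕ → ℕ) (t : Option (Fin N)) :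
    ∑ s, ext x s * l.matrix s t = ext ((l.map Fin.val).act x) t := by
  cases l with
  | inc i =>
    simp only [Instr.matrix, mul_add, Finset.sum_add_distrib, mul_ite, mul_one, mul_zero,
      Finset.sum_ite_eq', Finset.mem_univ, if_true]
    cases t with
    | none => simp [ext]
    | some j =>
      by_cases h : j = i
      · subst h
        simp [ext, Instr.map, Instr.act]
      · simp [ext, Instr.map, Instr.act, h, Fin.val_inj]
  | clr i =>
    simp only [Instr.matrix, mul_ite, mul_one, mul_zero,
      Finset.sum_ite_eq', Finset.mem_univ, if_true]
    cases t with
    | none => simp [ext]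
    | some j =>
      by_cases h : j = i
      · subst h
        simp [ext, Instr.map, Instr.act]
      · simp [ext, Instr.map, Instr.act, h, Fin.val_inj]
  | eq i j => simp [Instr.matrix, Instr.map, Instr.act]

theorem sum_form {N : ℕ} (l : Instr (Fin N)) (x : ℕ → ℕ) (b : Bool) :
    ∑ p : Option (Fin N) × Option (Fin N), ext x p.1 * ext x p.2 * l.form b p =
      (l.map Fin.val).penalty x b := by
  cases l with
  | inc i => simp [Instr.form, Instr.penalty, Instr.map]
  | clr i => simp [Instr.form, Instr.penalty, Instr.map]
  | eq i j =>
    cases b <;>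
    simp only [Instr.form, Instr.penalty, Instr.map, mul_add, Finset.sum_add_distrib, mul_ite,
      mul_one, mul_zero, Finset.sum_ite_eq', Finset.mem_univ, if_true, ext]

/-- If a vector is transformed by a matrix, its tensor square is transformed by the tensor square of
the matrix. Penalties are quadratic in the old registers, hence linear in the old coordinates. -/
theorem sum_coords_mul {N : ℕ} (l : Instr (Fin N)) (x : ℕ → ℕ) (e : Bool → ℕ) (m : Mono N) :
    ∑ m', coords x e m' * l.monoMatrix m' m =
      coords ((l.map Fin.val).act x) (fun b => e b + (l.map Fin.val).penalty x b) m := by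
  rw [Fintype.sum_sum_type]
  rcases m with ⟨t, t'⟩ | b
  · simp only [coords, Instr.monoMatrix, mul_zero, Finset.sum_const_zero, add_zero,
      ← sum_ext_mul_matrix, Fintype.sum_prod_type, Finset.sum_mul_sum]
    exact Finset.sum_congr rfl fun _ _ => Finset.sum_congr rfl fun _ _ => by ring
  · simp only [coords, Instr.monoMatrix, mul_ite, mul_one, mul_zero,
      Finset.sum_ite_eq', Finset.mem_univ, if_true, sum_form]
    rw [add_comm]

/-- Registers and accumulators after the execution of a word, ignoring failures. -/
def final : List (Instr ℕ) → (ℕ → ℕ) → (Bool → ℕ) → (ℕ → ℕ) × (Bool → ℕ)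
  | [], x, e => (x, e)
  | l :: w, x, e => final w (l.act x) fun b => e b + l.penalty x b

/-- For a test the two increments differ by the square of the difference of the registers. Keeping
two accumulators avoids negative matrix entries. -/
theorem penalty_le (l : Instr ℕ) (x : ℕ → ℕ) : l.penalty x false ≤ l.penalty x true := by
  cases l with
  | eq i j =>
    simp only [Instr.penalty]
    zify
    nlinarith [sq_nonneg ((x i : ℤ) - x j)]
  | _ => exact le_rfl

theorem penalty_le_iff (l : Instr ℕ) (x : ℕ → ℕ) :
    l.penalty x true ≤ l.penalty x false ↔ l.Ok x := by
  cases l with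
  | eq i j =>
    simp only [Instr.penalty, Instr.Ok]
    constructor
    · intro h
      zify at h ⊢
      have : ((x i : ℤ) - x j) ^ 2 ≤ 0 := by nlinarith
      exact sub_eq_zero.1 (pow_eq_zero_iff two_ne_zero |>.1 (le_antisymm this (sq_nonneg _)))
    · intro h
      rw [h]
  | _ => simp [Instr.penalty, Instr.Ok]

/-- No instruction decreases the gap between the accumulators, so a failure is never forgotten. -/
theorem final_le (w : List (Instr ℕ)) (x : ℕ → ℕ) (e : Bool → ℕ) (c : ℕ)
    (h : e false + c ≤ e true) : (final w x e).2 false + c ≤ (final w x e).2 true := by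
  induction w generalizing x e with
  | nil => exact h
  | cons l w ih =>
    have := penalty_le l x
    exact ih _ _ (by omega)

/-- The gap is a natural number: it stays 0 as long as all tests succeed, and is at least 1 from the
first failure on. Execution after a failure is harmless. -/
theorem exec_iff_final (w : List (Instr ℕ)) (x : ℕ → ℕ) (e : Bool → ℕ) (he : e true = e false) :
    (∃ y, Exec w x y) ↔ (final w x e).2 true < 1 + (final w x e).2 false := by
  induction w generalizing x e with
  | nil => simp [Exec, final, he]
  | cons l w ih =>
    simp only [Exec, final]
    by_cases hl : l.Ok x
    · simp only [hl, true_and]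
      refine ih _ _ ?_
      have := penalty_le l x
      have := (penalty_le_iff l x).2 hl
      omega
    · simp only [hl, false_and, exists_false, false_iff, not_lt]
      rw [add_comm]
      refine final_le _ _ _ _ ?_
      have := mt (penalty_le_iff l x).1 hl
      omega

/-- The action of a matrix on a row vector. -/
def step {D : Type} [Fintype D] (v : D → ℕ) (T : D → D → ℕ) : D → ℕ :=
  fun d => ∑ d', v d' * T d' d

/-- The product of an automaton with the action of the instructions on coordinates. -/
def prodMatrix {N : ℕ} {σ : Type} [DecidableEq σ] (M : DFA (Instr (Fin N)) σ)
    (l : Instr (Fin N)) (d d' : σ × Mono N) : ℕ :=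
  if d'.1 = M.step d.1 l then l.monoMatrix d.2 d'.2 else 0

/-- As the automaton is deterministic, the vector stays supported on the block of the current state.
-/
theorem foldl_prodMatrix {N : ℕ} {σ : Type} [DecidableEq σ] [Fintype σ]
    (M : DFA (Instr (Fin N)) σ) (w : List (Instr (Fin N))) (x : ℕ → ℕ) (e : Bool → ℕ) (s : σ) :
    w.foldl (fun v l => step v (prodMatrix M l))
      (fun d => if d.1 = s then coords x e d.2 else 0) =
    fun d => if d.1 = M.evalFrom s w then
      coords (final (w.map (Instr.map Fin.val)) x e).1
        (final (w.map (Instr.map Fin.val)) x e).2 d.2 else 0 := by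
  induction w generalizing x e s with
  | nil => rfl
  | cons l w ih =>
    rw [List.foldl_cons, List.map_cons, final, DFA.evalFrom_cons, ← ih]
    congr 1
    funext d
    simp only [step, prodMatrix, Fintype.sum_prod_type, ite_mul, zero_mul]
    rw [Finset.sum_eq_single s (fun t _ ht => by simp [ht]) (by simp)]
    simp only [if_true, mul_ite, mul_zero]
    split_ifs with h
    · exact sum_coords_mul l x e d.2
    · simp

/-- The halting problem for a partial recursive function as a threshold problem for products of
matrices of natural numbers. -/
theorem exists_matrices {f : ℕ →. ℕ} (hf : Partrec f) :
    ∃ (Λ D : Type) (_ : Fintype Λ) (_ : Fintype D) (T : Λ → D → D → ℕ) (u : ℕ → D → ℕ)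
      (a b : D → ℕ), (∀ n, ∑ d, u n d = (n + 1) ^ 2) ∧
      (∀ d, (∀ n, u n d = 0) ∨ ∃ e, ∀ n, u n d = n ^ e) ∧
      ∀ n, (f n).Dom ↔ ∃ w : List Λ,
        ∑ d, w.foldl (fun v l => step v (T l)) (u n) d * b d <
        ∑ d, w.foldl (fun v l => step v (T l)) (u n) d * a d := by
  classical
  obtain ⟨P, hP⟩ := exists_prog_of_partrec hf
  obtain ⟨N, σ, hσ, M, hN, hM⟩ := P.exists_dfa
  let reg : ℕ → ℕ → ℕ := fun n r => if r = 0 then n else 0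
  refine ⟨Instr (Fin N), σ × Mono N, inferInstance, inferInstance, prodMatrix M,
    fun n d => if d.1 = M.start then coords (reg n) (fun _ => 0) d.2 else 0,
    -- On accepted words the weight `a` reads off 1 plus the accumulator `false`, the 1 being the
    -- coordinate `(none, none)`; the weight `b` reads off the accumulator `true`. On rejected words
    -- both give 0, so the strict inequality fails.
    fun d => if d.1 ∈ M.accept then if d.2 = .inl (none, none) ∨ d.2 = .inr false then 1 else 0
      else 0,
    fun d => if d.1 ∈ M.accept then if d.2 = .inr true then 1 else 0 else 0, ?_, ?_, ?_⟩
  · intro n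
    -- Only the constant 1 and register `0`, with value `n`, contribute; summing all products
    -- squares this sum.
    have hext : ∑ s : Option (Fin N), ext (reg n) s = n + 1 := by
      obtain ⟨N, rfl⟩ := Nat.exists_eq_succ_of_ne_zero hN.ne'
      simp [Fintype.sum_option, ext, reg, Fin.val_eq_zero_iff, add_comm]
    rw [Fintype.sum_prod_type, Finset.sum_eq_single M.start (fun t _ ht => by simp [ht]) (by simp)]
    simp only [if_true, Fintype.sum_sum_type, coords, Finset.sum_const_zero, add_zero,
      Fintype.sum_prod_type, ← Finset.sum_mul_sum, hext]
    ring
  · have hext : ∀ s : Option (Fin N),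
        (∀ n, ext (reg n) s = 0) ∨ ∃ e, ∀ n, ext (reg n) s = n ^ e := by
      rintro (_ | i)
      · exact Or.inr ⟨0, fun n => by simp [ext]⟩
      · by_cases h : (i : ℕ) = 0
        · exact Or.inr ⟨1, fun n => by simp [ext, reg, h]⟩
        · exact Or.inl fun n => by simp [ext, reg, h]
    rintro ⟨q, m⟩
    by_cases hq : q = M.start
    · rcases m with ⟨s, t⟩ | b
      · simp only [hq, if_true, coords]
        rcases hext s with hs | ⟨e, hs⟩
        · exact Or.inl fun n => by simp [hs]
        · rcases hext t with ht | ⟨e', ht⟩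
          · exact Or.inl fun n => by simp [ht]
          · exact Or.inr ⟨e + e', fun n => by rw [hs, ht, pow_add]⟩
      · exact Or.inl fun n => by simp [coords]
    · exact Or.inl fun n => by simp [hq]
  · intro n
    rw [← hP, hM]
    refine exists_congr fun w => ?_
    simp only [foldl_prodMatrix, Fintype.sum_prod_type, DFA.mem_accepts, DFA.eval]
    generalize M.evalFrom M.start w = q
    rw [exec_iff_final _ _ (fun _ => 0) rfl]
    rw [Finset.sum_eq_single q (fun t _ ht => by simp [ht]) (by simp),
      Finset.sum_eq_single q (fun t _ ht => by simp [ht]) (by simp)]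
    by_cases hq : q ∈ M.accept
    · simp only [hq, if_true, mul_ite, mul_one, mul_zero, Finset.sum_ite_eq', true_and,
        Finset.mem_univ, Fintype.sum_sum_type, Fintype.sum_prod_type, coords]
      simp [ext, Finset.sum_ite_eq', Prod.ext_iff, ite_and, reg]
    · simp [hq]

end RegisterProgram

-- Conditional probabilities under perfect recall as forward probabilities

namespace PerfectRecall.PODTMC

open MeasureTheory ProbabilityTheory

theorem measurableSet_prefix {S Obs : Type} [MeasurableSpace S] [DiscreteMeasurableSpace S]
    (os : ℕ → Obs) (o : S → Obs) (m : ℕ) :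
    MeasurableSet {ρ : ℕ → S | ∀ j ≤ m, o (ρ j) = os j} := by
  have : {ρ : ℕ → S | ∀ j ≤ m, o (ρ j) = os j} =
      ⋂ j, ⋂ _ : j ≤ m, (fun ρ : ℕ → S => ρ j) ⁻¹' {s | o s = os j} := by
    ext ρ
    simp
  rw [this]
  exact MeasurableSet.iInter fun j => MeasurableSet.iInter fun _ =>
    (measurable_pi_apply j) MeasurableSet.of_discrete

theorem measurableSet_eval {S : Type} [MeasurableSpace S] [DiscreteMeasurableSpace S]
    (m : ℕ) (p : S → Prop) : MeasurableSet {ρ : ℕ → S | p (ρ m)} :=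
  (measurable_pi_apply m) (MeasurableSet.of_discrete (s := {s | p s}))

variable {Agt S Obs AP : Type} [Fintype S]

/-- The probability that the chain is in state `t` at time `m` and that the observations of agent
`i` up to then are `os 0, …, os m`. -/
noncomputable def forward [DecidableEq Obs] (M : PODTMC Agt S Obs AP) (i : Agt) (os : ℕ → Obs) :
    ℕ → S → ℝ
  | 0, t => if M.obs i t = os 0 then M.init t else 0
  | m + 1, t => if M.obs i t = os (m + 1) then ∑ s, M.forward i os m s * M.trans s t else 0

theorem forward_nonneg [DecidableEq Obs] (M : PODTMC Agt S Obs AP) (i : Agt) (os : ℕ → Obs)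
    (m : ℕ) (t : S) : 0 ≤ M.forward i os m t := by
  induction m generalizing t with
  | zero =>
    rw [forward]
    split_ifs
    exacts [M.init_nonneg t, le_rfl]
  | succ m ih =>
    rw [forward]
    split_ifs
    exacts [Finset.sum_nonneg fun s _ => mul_nonneg (ih s) (M.trans_nonneg s t), le_rfl]

variable [MeasurableSpace S] [DiscreteMeasurableSpace S]

instance (M : PODTMC Agt S Obs AP) : IsProbabilityMeasure M.initPMF.toMeasure :=
  PMF.toMeasure.isProbabilityMeasure _

instance (M : PODTMC Agt S Obs AP) : IsProbabilityMeasure M.seqMeasure := by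
  unfold seqMeasure; infer_instance

theorem seqMeasure_zero (M : PODTMC Agt S Obs AP) (s : S) :
    M.seqMeasure {ρ | ρ 0 = s} = ENNReal.ofReal (M.init s) := by
  have h : M.seqMeasure.map (Preorder.frestrictLe (π := fun _ => S) 0) =
      M.initPMF.toMeasure.map (MeasurableEquiv.piUnique fun _ : Finset.Iic 0 => S).symm := by
    rw [seqMeasure, Kernel.trajMeasure, Measure.map_comp _ _ (by fun_prop),
      Kernel.traj_map_frestrictLe, Kernel.partialTraj_self, Measure.id_comp]
  have h' := DFunLike.congr_fun h {x | x ⟨0, Finset.mem_Iic.2 le_rfl⟩ = s}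
  rw [Measure.map_apply (by fun_prop) (MeasurableSet.of_discrete),
    Measure.map_apply (MeasurableEquiv.measurable _) (MeasurableSet.of_discrete)] at h'
  refine h'.trans ?_
  have : (MeasurableEquiv.piUnique fun _ : Finset.Iic 0 => S).symm ⁻¹'
      {x | x ⟨0, Finset.mem_Iic.2 le_rfl⟩ = s} = {s} := by
    ext t
    rfl
  rw [this, PMF.toMeasure_apply_singleton _ _ (measurableSet_singleton s)]
  rfl

/-- This is the Markov property: the kernel of the next state is constant on the histories that end
in `s`. -/
theorem seqMeasure_succ (M : PODTMC Agt S Obs AP) (m : ℕ) (E : Set (Finset.Iic m → S)) (s t : S) :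
    M.seqMeasure {ρ | (Preorder.frestrictLe (π := fun _ => S) m ρ ∈ E ∧ ρ m = s) ∧ ρ (m + 1) = t} =
      M.seqMeasure {ρ | Preorder.frestrictLe (π := fun _ => S) m ρ ∈ E ∧ ρ m = s} *
        ENNReal.ofReal (M.trans s t) := by
  have h := Kernel.map_frestrictLe_trajMeasure_compProd_eq_map_trajMeasure
    (X := fun _ => S) (κ := M.histKernel) (μ₀ := M.initPMF.toMeasure) (a := m)
  let E' : Set (Finset.Iic m → S) := {x | x ∈ E ∧ x ⟨m, Finset.mem_Iic.2 le_rfl⟩ = s}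
  have h' := DFunLike.congr_fun h (E' ×ˢ {t})
  rw [Measure.map_apply (by fun_prop) (MeasurableSet.of_discrete),
    Measure.compProd_apply_prod MeasurableSet.of_discrete MeasurableSet.of_discrete] at h'
  have hset : (fun x : ℕ → S => (Preorder.frestrictLe (π := fun _ => S) m x, x (m + 1))) ⁻¹'
      (E' ×ˢ {t}) =
      {ρ | (Preorder.frestrictLe (π := fun _ => S) m ρ ∈ E ∧ ρ m = s) ∧ ρ (m + 1) = t} := by
    ext ρ
    rfl
  rw [hset] at h'
  refine h'.symm.trans ?_
  rw [setLIntegral_congr_fun (g := fun _ => ENNReal.ofReal (M.trans s t)) MeasurableSet.of_discrete]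
  · rw [setLIntegral_const, Measure.map_apply (by fun_prop) (MeasurableSet.of_discrete), mul_comm]
    rfl
  · rintro x ⟨-, hx⟩
    change (M.stepPMF (x ⟨m, Finset.mem_Iic.2 le_rfl⟩)).toMeasure {t} = _
    rw [hx, PMF.toMeasure_apply_singleton _ _ (measurableSet_singleton t)]
    rfl

/-- Splitting according to the state at time `m` turns the Markov property into the recursion of
`forward`. -/
theorem seqMeasure_prefix [DecidableEq Obs] (M : PODTMC Agt S Obs AP) (i : Agt) (os : ℕ → Obs)
    (m : ℕ) (t : S) :
    M.seqMeasure {ρ | (∀ j ≤ m, M.obs i (ρ j) = os j) ∧ ρ m = t} =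
      ENNReal.ofReal (M.forward i os m t) := by
  induction m generalizing t with
  | zero =>
    rw [forward]
    split_ifs with h
    · rw [← seqMeasure_zero]
      congr 1
      ext ρ
      simp only [Nat.le_zero, forall_eq, Set.mem_ofPred_eq, and_iff_right_iff_imp]
      rintro rfl
      exact h
    · convert measure_empty (μ := M.seqMeasure)
      · ext ρ
        simp only [Nat.le_zero, forall_eq, Set.mem_ofPred_eq, Set.mem_empty_iff_false, iff_false]
        rintro ⟨h1, rfl⟩
        exact h h1
      · simp
  | succ m ih =>
    rw [forward]
    split_ifs with h
    · have hset : {ρ : ℕ → S | (∀ j ≤ m + 1, M.obs i (ρ j) = os j) ∧ ρ (m + 1) = t} =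
          ⋃ s ∈ (Finset.univ : Finset S),
            {ρ | ((∀ j ≤ m, M.obs i (ρ j) = os j) ∧ ρ m = s) ∧ ρ (m + 1) = t} := by
        ext ρ
        simp only [Finset.mem_univ, Set.iUnion_true, Set.mem_iUnion, Set.mem_ofPred_eq]
        constructor
        · rintro ⟨h1, h2⟩
          exact ⟨ρ m, ⟨fun j hj => h1 j (by omega), rfl⟩, h2⟩
        · rintro ⟨s, ⟨h1, -⟩, h2⟩
          refine ⟨fun j hj => ?_, h2⟩
          rcases hj.lt_or_eq with hj | rfl
          · exact h1 j (by omega)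
          · rw [h2, h]
      rw [hset, measure_biUnion_finset]
      · rw [ENNReal.ofReal_sum_of_nonneg fun s _ =>
          mul_nonneg (forward_nonneg M i os m s) (M.trans_nonneg s t)]
        refine Finset.sum_congr rfl fun s _ => ?_
        rw [ENNReal.ofReal_mul (forward_nonneg M i os m s), ← ih s]
        have := M.seqMeasure_succ m {x | ∀ j : Finset.Iic m, M.obs i (x j) = os j} s t
        simpa using this
      · intro s _ s' _ hss
        refine Set.disjoint_left.2 ?_
        rintro ρ ⟨⟨-, h1⟩, -⟩ ⟨⟨-, h2⟩, -⟩
        exact hss (h1.symm.trans h2)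
      · intro s _
        exact ((measurableSet_prefix os (M.obs i) m).inter
          (measurableSet_eval m (· = s))).inter (measurableSet_eval (m + 1) (· = t))
    · convert measure_empty (μ := M.seqMeasure)
      · ext ρ
        simp only [Set.mem_ofPred_eq, Set.mem_empty_iff_false, iff_false]
        rintro ⟨h1, rfl⟩
        exact h (h1 (m + 1) le_rfl)
      · simp

theorem seqMeasure_prefix_sum [DecidableEq Obs] (M : PODTMC Agt S Obs AP) (i : Agt)
    (os : ℕ → Obs) (m : ℕ) (T : Finset S) :
    M.seqMeasure {ρ | (∀ j ≤ m, M.obs i (ρ j) = os j) ∧ ρ m ∈ T} =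
      ENNReal.ofReal (∑ t ∈ T, M.forward i os m t) := by
  have hset : {ρ : ℕ → S | (∀ j ≤ m, M.obs i (ρ j) = os j) ∧ ρ m ∈ T} =
      ⋃ t ∈ T, {ρ | (∀ j ≤ m, M.obs i (ρ j) = os j) ∧ ρ m = t} := by
    ext ρ
    simp
  rw [hset, measure_biUnion_finset]
  · rw [ENNReal.ofReal_sum_of_nonneg fun t _ => forward_nonneg M i os m t]
    exact Finset.sum_congr rfl fun t _ => M.seqMeasure_prefix i os m t
  · intro s _ s' _ hss
    refine Set.disjoint_left.2 ?_
    rintro ρ ⟨-, h1⟩ ⟨-, h2⟩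
    exact hss (h1.symm.trans h2)
  · intro s _
    exact (measurableSet_prefix os (M.obs i) m).inter (measurableSet_eval m (· = s))

/-- A sequence that is not a path has a start or, at some time, a step of probability zero; these
are countably many null events. -/
theorem ae_isPath (M : PODTMC Agt S Obs AP) : ∀ᵐ ρ ∂M.seqMeasure, M.IsPath ρ := by
  have h0 : ∀ᵐ ρ ∂M.seqMeasure, M.init (ρ 0) ≠ 0 := by
    have : ∀ s, M.init s = 0 → ∀ᵐ ρ ∂M.seqMeasure, ρ 0 ≠ s := by
      intro s hs
      rw [ae_iff]
      simp only [ne_eq, not_not]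
      rw [seqMeasure_zero, hs, ENNReal.ofReal_zero]
    have := ae_all_iff.2 fun s => ae_all_iff.2 (this s)
    filter_upwards [this] with ρ hρ h
    exact hρ _ h rfl
  have h1 : ∀ᵐ ρ ∂M.seqMeasure, ∀ k, 0 < M.trans (ρ k) (ρ (k + 1)) := by
    refine ae_all_iff.2 fun k => ?_
    have : ∀ s t, M.trans s t = 0 → ∀ᵐ ρ ∂M.seqMeasure, ¬ (ρ k = s ∧ ρ (k + 1) = t) := by
      intro s t hst
      rw [ae_iff]
      have := M.seqMeasure_succ k Set.univ s t
      simpa [hst] using this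
    have := ae_all_iff.2 fun s => ae_all_iff.2 fun t => ae_all_iff.2 (this s t)
    filter_upwards [this] with ρ hρ
    exact (M.trans_nonneg _ _).lt_of_ne' fun h => hρ _ _ h ⟨rfl, rfl⟩
  filter_upwards [h0, h1] with ρ h h' using ⟨h, h'⟩

theorem measurableSet_isPath (M : PODTMC Agt S Obs AP) : MeasurableSet {ρ | M.IsPath ρ} := by
  have : {ρ | M.IsPath ρ} = {ρ : ℕ → S | M.init (ρ 0) ≠ 0} ∩
      ⋂ k, (fun ρ : ℕ → S => (ρ k, ρ (k + 1))) ⁻¹' {p | 0 < M.trans p.1 p.2} := by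
    ext ρ
    simp [IsPath]
  rw [this]
  exact (measurableSet_eval 0 (M.init · ≠ 0)).inter (MeasurableSet.iInter fun k =>
    ((measurable_pi_apply k).prodMk (measurable_pi_apply (k + 1))) MeasurableSet.of_discrete)

theorem pathMeasure_apply (M : PODTMC Agt S Obs AP) {A : Set (ℕ → S)} :
    M.pathMeasure {ρ : M.Path | ρ.1 ∈ A} = M.seqMeasure A := by
  refine ((MeasurableEmbedding.subtype_coe M.measurableSet_isPath).comap_apply _ _).trans ?_
  have : (Subtype.val '' {ρ : M.Path | ρ.1 ∈ A} : Set (ℕ → S)) = A ∩ {ρ | M.IsPath ρ} := by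
    ext ρ
    constructor
    · rintro ⟨ρ, h, rfl⟩
      exact ⟨h, ρ.2⟩
    · rintro ⟨h, h'⟩
      exact ⟨⟨ρ, h'⟩, h, rfl⟩
  refine (congrArg M.seqMeasure this).trans ?_
  exact measure_inter_conull (ae_iff.1 M.ae_isPath)

theorem exists_path_mem (M : PODTMC Agt S Obs AP) {A : Set (ℕ → S)} (hA : M.seqMeasure A ≠ 0) :
    ∃ ρ : M.Path, ρ.1 ∈ A := by
  by_contra! h
  rw [← pathMeasure_apply] at hA
  refine hA ?_
  convert measure_empty (μ := M.pathMeasure)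
  ext ρ
  simpa using h ρ

/-- The events on runs are exactly the sets whose preimage among the paths is measurable, so the
prior can be computed on state sequences. -/
theorem sprSystem_prior_apply (M : PODTMC Agt S Obs AP) {A : Set (ℕ → S)} (hA : MeasurableSet A)
    {B : Set M.sprSystem.runs} (hB : ∀ ρ : M.Path, M.toSprRuns ρ ∈ B ↔ ρ.1 ∈ A) :
    M.sprSystem.prior B = M.seqMeasure A := by
  have hpre : M.toSprRuns ⁻¹' B = {ρ : M.Path | ρ.1 ∈ A} := Set.ext hB
  have hmeas : @Measurable _ _ _ (MeasurableSpace.map M.toSprRuns inferInstance) M.toSprRuns :=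
    fun _ h => h
  have hmB : MeasurableSet[MeasurableSpace.map M.toSprRuns inferInstance] B := by
    change MeasurableSet (M.toSprRuns ⁻¹' B)
    rw [hpre]
    exact measurable_subtype_coe hA
  rw [← pathMeasure_apply, ← hpre]
  exact @Measure.map_apply _ _ _ (MeasurableSpace.map M.toSprRuns inferInstance) _ _ hmeas _ hmB

/-- The length of the list of observations reveals the time: this is where synchrony enters. -/
theorem localState_eq_iff (M : PODTMC Agt S Obs AP) (i : Agt) (ρ ρ' : M.Path) (m m' : ℕ) :
    M.sprSystem.localState i (M.toSprRuns ρ', m') = M.sprSystem.localState i (M.toSprRuns ρ, m) ↔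
      m' = m ∧ ∀ j ≤ m, M.obs i (ρ'.1 j) = M.obs i (ρ.1 j) := by
  change (List.ofFn fun j : Fin (m' + 1) => M.obs i (ρ'.1 j)) =
    (List.ofFn fun j : Fin (m + 1) => M.obs i (ρ.1 j)) ↔ _
  constructor
  · intro h
    obtain rfl : m' = m := by simpa using congrArg List.length h
    refine ⟨rfl, fun j hj => ?_⟩
    exact congrFun (List.ofFn_injective h) ⟨j, by omega⟩
  · rintro ⟨rfl, h⟩
    congr 1
    funext j
    exact h j (by omega)

theorem mem_runsThrough_indist (M : PODTMC Agt S Obs AP) (i : Agt) (ρ ρ' : M.Path) (m : ℕ) :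
    M.toSprRuns ρ' ∈ M.sprSystem.runsThrough (M.sprSystem.indist i (M.toSprRuns ρ, m)) ↔
      ∀ j ≤ m, M.obs i (ρ'.1 j) = M.obs i (ρ.1 j) :=
  ⟨fun ⟨m', h⟩ => ((localState_eq_iff M i ρ ρ' m m').1 h).2,
    fun h => ⟨m, (localState_eq_iff M i ρ ρ' m m).2 ⟨rfl, h⟩⟩⟩

/-- By synchrony, sets of indistinguishable points involve a single time, so passing to runs loses
nothing and both measures are sums of forward probabilities. -/
theorem agentProb_eq [DecidableEq Obs] (M : PODTMC Agt S Obs AP) (i : Agt) (p : AP)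
    [DecidablePred fun s => p ∈ M.val s] (ρ : M.Path) (m : ℕ) :
    M.sprSystem.agentProb i (M.toSprRuns ρ, m)
      {y | y ∈ M.sprSystem.indist i (M.toSprRuns ρ, m) ∧ Sat M.sprSystem (.atom p) y} =
    (∑ t with p ∈ M.val t, M.forward i (fun j => M.obs i (ρ.1 j)) m t) /
      ∑ t, M.forward i (fun j => M.obs i (ρ.1 j)) m t := by
  have hsat : ∀ (ρ' : M.Path) (m' : ℕ),
      Sat M.sprSystem (.atom p) (M.toSprRuns ρ', m') ↔ p ∈ M.val (ρ'.1 m') := by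
    intro ρ' m'
    rw [Sat]
    rfl
  rw [PriorSystem.agentProb,
    M.sprSystem_prior_apply (A := {ρ' | (∀ j ≤ m, M.obs i (ρ' j) = M.obs i (ρ.1 j)) ∧
      ρ' m ∈ Finset.univ.filter fun t => p ∈ M.val t}),
    M.sprSystem_prior_apply (A := {ρ' | (∀ j ≤ m, M.obs i (ρ' j) = M.obs i (ρ.1 j)) ∧
      ρ' m ∈ Finset.univ}),
    seqMeasure_prefix_sum M i fun j => M.obs i (ρ.1 j),
    seqMeasure_prefix_sum M i fun j => M.obs i (ρ.1 j),
    ENNReal.toReal_ofReal (Finset.sum_nonneg fun t _ => forward_nonneg M i _ m t),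
    ENNReal.toReal_ofReal (Finset.sum_nonneg fun t _ => forward_nonneg M i _ m t)]
  · exact (measurableSet_prefix _ (M.obs i) m).inter (measurableSet_eval m (· ∈ Finset.univ))
  · intro ρ'
    exact (mem_runsThrough_indist M i ρ ρ' m).trans (by simp)
  · exact (measurableSet_prefix _ (M.obs i) m).inter
      (measurableSet_eval m (· ∈ Finset.univ.filter fun t => p ∈ M.val t))
  · intro ρ'
    constructor
    · rintro ⟨⟨m', h, h'⟩, -⟩
      obtain ⟨rfl, h⟩ := (localState_eq_iff M i ρ ρ' m m').1 h
      exact ⟨h, by simpa using (hsat ρ' m').1 h'⟩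
    · rintro ⟨h, h'⟩
      exact ⟨⟨m, (localState_eq_iff M i ρ ρ' m m).2 ⟨rfl, h⟩, (hsat ρ' m).2 (by simpa using h')⟩,
        (mem_runsThrough_indist M i ρ ρ' m).2 h⟩

theorem sat_eventually_probGt [DecidableEq Obs] (M : PODTMC Agt S Obs AP) (i : Agt) (p : AP)
    [DecidablePred fun s => p ∈ M.val s] (c : ℚ) (ρ : M.Path) :
    Sat M.sprSystem (Formula.eventually (Formula.probGt i (.atom p) c)) (M.toSprRuns ρ, 0) ↔
    ∃ m, (c : ℝ) < (∑ t with p ∈ M.val t, M.forward i (fun j => M.obs i (ρ.1 j)) m t) /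
      ∑ t, M.forward i (fun j => M.obs i (ρ.1 j)) m t := by
  rw [Formula.eventually, Sat]
  refine exists_congr fun m => ?_
  rw [Formula.probGt, Sat, ← agentProb_eq]
  simp only [MvPolynomial.aeval_X, termVal, Cmp.Holds, Formula.top, Sat]
  simp

/-- For a chain with a single initial state, `EF (Pr_i(p) > c)` means that some sequence of
observations of positive probability makes the conditional probability of `p` exceed `c`. -/
theorem sprModels_iff [DecidableEq Obs] (M : PODTMC Agt S Obs AP) (i : Agt) (p : AP)
    [DecidablePred fun s => p ∈ M.val s] {c : ℚ} (hc : 0 ≤ c) (s₀ : S)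
    (hs₀ : ∀ s, s ≠ s₀ → M.init s = 0) :
    M.SprModels (Formula.ex (Formula.eventually (Formula.probGt i (.atom p) c))) ↔
    ∃ (os : ℕ → Obs) (m : ℕ), c * ∑ t, M.forward i os m t <
      ∑ t with p ∈ M.val t, M.forward i os m t := by
  have hstart : ∀ ρ : M.Path, ρ.1 0 = s₀ := fun ρ => by
    by_contra h
    exact ρ.2.1 (hs₀ _ h)
  have key : M.SprModels (Formula.ex (Formula.eventually (Formula.probGt i (.atom p) c))) ↔
      ∃ ρ : M.Path, ∃ m, (c : ℝ) <
        (∑ t with p ∈ M.val t, M.forward i (fun j => M.obs i (ρ.1 j)) m t) /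
        ∑ t, M.forward i (fun j => M.obs i (ρ.1 j)) m t := by
    have hsat : ∀ r, Sat M.sprSystem (Formula.ex (Formula.eventually
        (Formula.probGt i (.atom p) c))) (r, 0) ↔ ∃ ρ : M.Path,
        M.sprRun ρ.1 0 = r.1 0 ∧ Sat M.sprSystem (Formula.eventually
          (Formula.probGt i (.atom p) c)) (M.toSprRuns ρ, 0) := by
      intro r
      simp only [Formula.ex, Sat, Nat.le_zero, forall_eq, not_forall, not_not]
      constructor
      · rintro ⟨⟨_, ρ, rfl⟩, h, h'⟩
        exact ⟨ρ, h, h'⟩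
      · rintro ⟨ρ, h, h'⟩
        exact ⟨M.toSprRuns ρ, h, h'⟩
    simp only [SprModels, hsat, sat_eventually_probGt]
    constructor
    · intro h
      -- Some path exists because the whole space has positive measure; hence the quantification
      -- over runs is not vacuous.
      obtain ⟨ρ, -⟩ := M.exists_path_mem (A := Set.univ) (by simp)
      obtain ⟨ρ', -, h'⟩ := h (M.toSprRuns ρ)
      exact ⟨ρ', h'⟩
    · rintro ⟨ρ', h⟩ ⟨_, ρ, rfl⟩
      refine ⟨ρ', ?_, h⟩
      have : ∀ j : Fin (0 + 1), ρ'.1 j = ρ.1 j := fun j => by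
        rw [Fin.fin_one_eq_zero j]
        exact (hstart ρ').trans (hstart ρ).symm
      exact Prod.ext (this 0) (funext fun a => by simp only [sprRun, this])
  rw [key]
  have hnn : ∀ os m, 0 ≤ ∑ t, M.forward i os m t := fun os m =>
    Finset.sum_nonneg fun t _ => forward_nonneg M i os m t
  have hc' : (0 : ℝ) ≤ c := by exact_mod_cast hc
  constructor
  · rintro ⟨ρ, m, h⟩
    -- With total mass 0 the quotient is 0 by convention, which does not exceed `c ≥ 0`.
    refine ⟨_, m, (lt_div_iff₀ ((hnn _ _).lt_of_ne' fun h0 => ?_)).1 h⟩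
    rw [h0, div_zero] at h
    exact absurd h (not_lt.2 hc')
  · rintro ⟨os, m, h⟩
    have hpos : 0 < ∑ t, M.forward i os m t := by
      refine (hnn _ _).lt_of_ne' fun h0 => ?_
      have : ∑ t with p ∈ M.val t, M.forward i os m t ≤ ∑ t, M.forward i os m t :=
        Finset.sum_le_sum_of_subset_of_nonneg (Finset.filter_subset _ _)
          fun t _ _ => forward_nonneg M i os m t
      rw [h0, mul_zero] at h
      linarith
    -- Observations of positive probability are realised by an actual path.
    obtain ⟨ρ, hρ, -⟩ := M.exists_path_mem
      (A := {ρ | (∀ j ≤ m, M.obs i (ρ j) = os j) ∧ ρ m ∈ Finset.univ})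
      (by rw [seqMeasure_prefix_sum]; simpa using hpos)
    have hfw : ∀ k ≤ m, ∀ t, M.forward i (fun j => M.obs i (ρ.1 j)) k t = M.forward i os k t := by
      intro k hk
      induction k with
      | zero => intro t; simp only [forward, hρ 0 hk]
      | succ k ih => intro t; simp only [forward, hρ (k + 1) hk, ih (by omega)]
    refine ⟨ρ, m, ?_⟩
    simp only [hfw m le_rfl]
    rwa [lt_div_iff₀ hpos]

end PerfectRecall.PODTMC

-- The Markov chain of a threshold problem

namespace RegisterProgram

open PerfectRecall

/-- States of the chain of a threshold problem: `inl (l, d)` are the coordinates `d` with the last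
matrix read, `inr (inl b)` are the final states, `inr (inr true)` is the initial state and
`inr (inr false)` is an absorbing state. -/
abbrev Node (Λ D : Type) : Type := (Option Λ × D) ⊕ (Bool ⊕ Bool)

/-- A threshold problem for products of matrices of natural numbers, with threshold probability
`c`: is `∑ d, v d * b d < ∑ d, v d * a d` for some product `v` of the row vector `u` and some of the
matrices `T l`? -/
structure Threshold (Λ D : Type) where
  T : Λ → D → D → ℕ
  u : D → ℕ
  a : D → ℕ
  b : D → ℕ
  c : ℚ

namespace Threshold

variable {Λ D : Type} [Fintype Λ] [Fintype D]

/-- A bound for the sums of the rows. -/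
def bound (P : Threshold Λ D) : ℕ := ∑ d, (∑ l, ∑ d', P.T l d d' + P.a d + P.b d) + 1

/-- The probabilities of the transitions to other states than the absorbing one. -/
def weight (P : Threshold Λ D) : Node Λ D → Node Λ D → ℚ
  | .inr (.inr true), .inl (none, d) => P.u d / ∑ d, P.u d
  | .inl (_, d), .inl (some l, d') => P.T l d d' / P.bound
  | .inl (_, d), .inr (.inl true) => P.c * P.a d / P.bound
  | .inl (_, d), .inr (.inl false) => (1 - P.c) * P.b d / P.bound
  | _, _ => 0

/-- The observation at a state. -/
noncomputable def observe : Node Λ D → ℕ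
  | .inr (.inr true) => 0
  | .inr (.inr false) => 1
  | .inr (.inl _) => 2
  | .inl (l, _) => 3 + Fintype.equivFin (Option Λ) l

theorem weight_nonneg (P : Threshold Λ D) (hc0 : 0 < P.c) (hc1 : P.c < 1) (s t : Node Λ D) :
    0 ≤ P.weight s t := by
  have := sub_pos.2 hc1
  unfold weight
  split <;> positivity

theorem sum_weight_start (P : Threshold Λ D) (hu : ∑ d, P.u d ≠ 0) :
    ∑ t, P.weight (.inr (.inr true)) t = 1 := by
  have : ((∑ d, P.u d : ℕ) : ℚ) ≠ 0 := by exact_mod_cast hu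
  push_cast at this
  simp [weight, Fintype.sum_sum_type, Fintype.sum_prod_type, Fintype.sum_option,
    ← Finset.sum_div, div_self this]

/-- The bound dominates every row sum, and the factors `c` and `1 - c` only decrease the entries.
The missing mass is what `prob` sends to the absorbing state. -/
theorem sum_weight_le (P : Threshold Λ D) (hu : ∑ d, P.u d ≠ 0) (hc0 : 0 < P.c) (hc1 : P.c < 1)
    (s : Node Λ D) : ∑ t, P.weight s t ≤ 1 := by
  rcases s with ⟨l, d⟩ | b | _ | _
  · have hB : (0 : ℚ) < P.bound := by simp [bound]; positivity
    have h : ∑ l, ∑ d', P.T l d d' + P.a d + P.b d ≤ P.bound := by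
      refine (Finset.single_le_sum (f := fun d => ∑ l, ∑ d', P.T l d d' + P.a d + P.b d)
        (fun _ _ => Nat.zero_le _) (Finset.mem_univ d)).trans (Nat.le_succ _)
    have h' : ((∑ l, ∑ d', P.T l d d' + P.a d + P.b d : ℕ) : ℚ) ≤ P.bound := by exact_mod_cast h
    push_cast at h'
    have ha : P.c * P.a d ≤ P.a d := mul_le_of_le_one_left (by positivity) hc1.le
    have hb : (1 - P.c) * P.b d ≤ P.b d := mul_le_of_le_one_left (by positivity) (by linarith)
    simp only [weight, Fintype.sum_sum_type, Fintype.sum_prod_type, Fintype.sum_option,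
      ← Finset.sum_div, Fintype.sum_bool, Finset.sum_const_zero, zero_add, add_zero]
    rw [← add_div, ← add_div, div_le_one hB]
    linarith
  · simp [weight]
  · simp [weight]
  · exact (P.sum_weight_start hu).le

/-- The observations `os` up to time `m + 1` spell the word `w`. -/
def Spells (os : ℕ → ℕ) (m : ℕ) (w : List Λ) : Prop :=
  w.length = m ∧ os 0 = 0 ∧
    ∀ j ≤ m, os (j + 1) = 3 + Fintype.equivFin (Option Λ) (w.take j).getLast?

theorem spells_nil {os : ℕ → ℕ} :
    Spells os 0 ([] : List Λ) ↔ os 0 = 0 ∧ os 1 = 3 + Fintype.equivFin (Option Λ) none := by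
  simp [Spells]

theorem spells_concat {os : ℕ → ℕ} {m : ℕ} {w : List Λ} {l : Λ} :
    Spells os (m + 1) (w ++ [l]) ↔
      Spells os m w ∧ os (m + 2) = 3 + Fintype.equivFin (Option Λ) (some l) := by
  simp only [Spells, List.length_append, List.length_singleton, add_left_inj]
  constructor
  · rintro ⟨h, h0, hj⟩
    refine ⟨⟨h, h0, fun j hjm => ?_⟩, ?_⟩
    · rw [hj j (by omega), List.take_append_of_le_length (by omega)]
    · have := hj (m + 1) le_rfl
      rwa [List.take_of_length_le (by simp [h]), List.getLast?_concat] at this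
  · rintro ⟨⟨h, h0, hj⟩, hl⟩
    refine ⟨h, h0, fun j hjm => ?_⟩
    rcases hjm.lt_or_eq with hjm | rfl
    · rw [hj j (by omega), List.take_append_of_le_length (by omega)]
    · rwa [List.take_of_length_le (by simp [h]), List.getLast?_concat]

variable [DecidableEq Λ] [DecidableEq D]

/-- The transition probabilities. -/
def prob (P : Threshold Λ D) (s t : Node Λ D) : ℚ :=
  P.weight s t + if t = .inr (.inr false) then 1 - ∑ t, P.weight s t else 0

theorem prob_nonneg (P : Threshold Λ D) (hu : ∑ d, P.u d ≠ 0) (hc0 : 0 < P.c) (hc1 : P.c < 1)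
    (s t : Node Λ D) : 0 ≤ P.prob s t := by
  refine add_nonneg (P.weight_nonneg hc0 hc1 s t) ?_
  split_ifs
  exacts [sub_nonneg.2 (P.sum_weight_le hu hc0 hc1 s), le_rfl]

theorem sum_prob (P : Threshold Λ D) (s : Node Λ D) : ∑ t, P.prob s t = 1 := by
  simp [prob, Finset.sum_add_distrib]

/-- The partially observed Markov chain of a threshold problem. -/
noncomputable def chain (P : Threshold Λ D) (hu : ∑ d, P.u d ≠ 0) (hc0 : 0 < P.c) (hc1 : P.c < 1)
    (n k : ℕ) : FinitePODTMC n k where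
  size := Fintype.card (Node Λ D)
  init s := if (Fintype.equivFin (Node Λ D)).symm s = .inr (.inr true) then 1 else 0
  trans s t := P.prob ((Fintype.equivFin (Node Λ D)).symm s) ((Fintype.equivFin (Node Λ D)).symm t)
  init_nonneg s := by split_ifs <;> norm_num
  init_sum := by
    rw [(Fintype.equivFin (Node Λ D)).symm.sum_comp
      fun s => if s = Sum.inr (.inr true) then (1 : ℚ) else 0]
    simp
  trans_nonneg s t := P.prob_nonneg hu hc0 hc1 _ _
  trans_sum s := by
    rw [(Fintype.equivFin (Node Λ D)).symm.sum_comp (P.prob _)]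
    exact P.sum_prob _
  obs _ s := observe ((Fintype.equivFin (Node Λ D)).symm s)
  val s _ := decide ((Fintype.equivFin (Node Λ D)).symm s = .inr (.inl true))

/-- The states of the chain, by their numbers. -/
noncomputable def node (P : Threshold Λ D) (hu : ∑ d, P.u d ≠ 0) (hc0 : 0 < P.c) (hc1 : P.c < 1)
    (n k : ℕ) : Fin (P.chain hu hc0 hc1 n k).size ≃ Node Λ D :=
  (Fintype.equivFin (Node Λ D)).symm

/-- The forward probabilities of the chain. -/
noncomputable def fwd (P : Threshold Λ D) (os : ℕ → ℕ) : ℕ → Node Λ D → ℝ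
  | 0, t => if observe t = os 0 then if t = .inr (.inr true) then 1 else 0 else 0
  | m + 1, t => if observe t = os (m + 1) then ∑ s, P.fwd os m s * P.prob s t else 0

theorem forward_chain (P : Threshold Λ D) (hu : ∑ d, P.u d ≠ 0) (hc0 : 0 < P.c) (hc1 : P.c < 1)
    {n k : ℕ} (i : Fin n) (os : ℕ → ℕ) (m : ℕ) (t : Fin (P.chain hu hc0 hc1 n k).size) :
    (P.chain hu hc0 hc1 n k).toPODTMC.forward i os m t = P.fwd os m (P.node hu hc0 hc1 n k t) := by
  induction m generalizing t with
  | zero =>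
    have h : (P.chain hu hc0 hc1 n k).toPODTMC.init t =
        if P.node hu hc0 hc1 n k t = .inr (.inr true) then 1 else 0 := by
      change ((if P.node hu hc0 hc1 n k t = .inr (.inr true) then 1 else 0 : ℚ) : ℝ) = _
      split_ifs <;> simp
    rw [PODTMC.forward, fwd, h]
    rfl
  | succ m ih =>
    rw [PODTMC.forward, fwd]
    simp only [ih]
    rw [← (P.node hu hc0 hc1 n k).sum_comp]
    rfl

section Forward

variable (P : Threshold Λ D) (os : ℕ → ℕ) (m : ℕ)

theorem fwd_start_succ : P.fwd os (m + 1) (.inr (.inr true)) = 0 := by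
  rw [fwd]
  simp [prob, weight]

theorem fwd_start_zero : P.fwd os 0 (.inr (.inr true)) = if os 0 = 0 then 1 else 0 := by
  simp [fwd, observe, eq_comm]

theorem fwd_inl_zero (p : Option Λ × D) : P.fwd os 0 (.inl p) = 0 := by
  simp [fwd]

theorem fwd_none_succ (d : D) : P.fwd os (m + 1) (.inl (none, d)) =
    if os (m + 1) = 3 + Fintype.equivFin (Option Λ) none then
      P.fwd os m (.inr (.inr true)) * (P.u d / ∑ d, P.u d) else 0 := by
  rw [fwd]
  simp [observe, prob, weight, eq_comm, Fintype.sum_sum_type]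

theorem fwd_some_succ (l : Λ) (d : D) : P.fwd os (m + 1) (.inl (some l, d)) =
    if os (m + 1) = 3 + Fintype.equivFin (Option Λ) (some l) then
      ∑ p : Option Λ × D, P.fwd os m (.inl p) * (P.T l p.2 d / P.bound) else 0 := by
  rw [fwd]
  simp [observe, prob, weight, eq_comm, Fintype.sum_sum_type]

theorem fwd_last_true_succ : P.fwd os (m + 1) (.inr (.inl true)) = if os (m + 1) = 2 then
    ∑ p : Option Λ × D, P.fwd os m (.inl p) * (P.c * P.a p.2 / P.bound) else 0 := by
  rw [fwd]
  simp [observe, prob, weight, eq_comm, Fintype.sum_sum_type]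

theorem fwd_last_false_succ : P.fwd os (m + 1) (.inr (.inl false)) = if os (m + 1) = 2 then
    ∑ p : Option Λ × D, P.fwd os m (.inl p) * ((1 - P.c) * P.b p.2 / P.bound) else 0 := by
  rw [fwd]
  simp [observe, prob, weight, eq_comm, Fintype.sum_sum_type]

theorem fwd_eq_zero {t : Node Λ D} (h : observe t ≠ os m) : P.fwd os m t = 0 := by
  cases m <;> rw [fwd, if_neg h]

end Forward

/-- The product of the row vector with the matrices of a word. -/
def value (P : Threshold Λ D) (w : List Λ) : D → ℕ := w.foldl (fun v l => step v (P.T l)) P.u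

/-- The word determines the observations, while the coordinate stays hidden and evolves by the
matrices. Time is shifted by one since the first step only draws the starting coordinate; each
letter then contributes one factor `bound`, independent of the coordinate. -/
theorem fwd_of_spells (P : Threshold Λ D) {os : ℕ → ℕ} {w : List Λ} {m : ℕ}
    (h : Spells os m w) (l : Option Λ) (d : D) :
    P.fwd os (m + 1) (.inl (l, d)) = if l = w.getLast? then
      (P.value w d : ℝ) / ((∑ d, P.u d : ℕ) * P.bound ^ m) else 0 := by
  induction w using List.reverseRecOn generalizing m l d with
  | nil =>
    obtain rfl : m = 0 := h.1.symm
    rw [spells_nil] at h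
    cases l with
    | none => simp [fwd_none_succ, fwd_start_zero, h, value]
    | some l => rw [fwd_some_succ]; simp [fwd_inl_zero]
  | append_singleton w l₀ ih =>
    obtain ⟨m, rfl⟩ : ∃ m', m = m' + 1 := ⟨w.length, by simpa using h.1.symm⟩
    rw [spells_concat] at h
    obtain ⟨h, hl⟩ := h
    rw [List.getLast?_concat]
    cases l with
    | none => simp [fwd_none_succ, fwd_start_succ]
    | some l =>
      rw [fwd_some_succ, hl]
      by_cases hll : l = l₀
      · subst hll
        simp only [if_true, Fintype.sum_prod_type, ih h, ite_mul, zero_mul]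
        rw [Finset.sum_comm]
        simp only [Finset.sum_ite_eq', Finset.mem_univ, if_true]
        have : P.value (w ++ [l]) d = ∑ d', P.value w d' * P.T l d' d := by
          simp [value, step]
        rw [this]
        push_cast
        rw [Finset.sum_div]
        refine Finset.sum_congr rfl fun d' _ => ?_
        rw [div_mul_div_comm, pow_succ, mul_assoc]
      · have : ¬ (some l = some l₀) := by simpa using hll
        rw [if_neg this, if_neg fun h => this ?_]
        simpa [Fin.val_inj] using h.symm

/-- A coordinate state marked `none` can only follow the initial state, and one marked `some l` only
another coordinate state; so positive mass forces the observations to come from a word. -/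
theorem exists_spells (P : Threshold Λ D) {os : ℕ → ℕ} {m : ℕ} {p : Option Λ × D}
    (h : P.fwd os (m + 1) (.inl p) ≠ 0) : ∃ w : List Λ, Spells os m w := by
  induction m generalizing p with
  | zero =>
    obtain ⟨_ | l, d⟩ := p
    · rw [fwd_none_succ, fwd_start_zero] at h
      refine ⟨[], spells_nil.2 ?_⟩
      by_contra h'
      refine h ?_
      rw [not_and_or] at h'
      rcases h' with h' | h' <;> simp [h']
    · simp [fwd_some_succ, fwd_inl_zero] at h
  | succ m ih =>
    obtain ⟨_ | l, d⟩ := p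
    · simp [fwd_none_succ, fwd_start_succ] at h
    · rw [fwd_some_succ] at h
      by_cases hl : os (m + 2) = 3 + Fintype.equivFin (Option Λ) (some l)
      · rw [if_pos hl] at h
        obtain ⟨q, -, hq⟩ := Finset.exists_ne_zero_of_sum_ne_zero h
        obtain ⟨w, hw⟩ := ih (left_ne_zero_of_mul hq)
        exact ⟨w ++ [l], spells_concat.2 ⟨hw, hl⟩⟩
      · exact absurd (if_neg hl) h

theorem sum_fwd_mul (P : Threshold Λ D) {os : ℕ → ℕ} {w : List Λ} {m : ℕ}
    (h : Spells os m w) (g : D → ℝ) :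
    ∑ p : Option Λ × D, P.fwd os (m + 1) (.inl p) * g p.2 =
      (∑ d, P.value w d * g d) / ((∑ d, P.u d : ℕ) * P.bound ^ m) := by
  simp only [Fintype.sum_prod_type, P.fwd_of_spells h, ite_mul, zero_mul]
  rw [Finset.sum_comm, Finset.sum_div]
  simp only [Finset.sum_ite_eq', Finset.mem_univ, if_true]
  exact Finset.sum_congr rfl fun d _ => by rw [div_mul_eq_mul_div]

/-- Up to a common positive factor the two masses are cA and (1 - c)B, and cA - c(cA + (1 - c)B) =
c(1 - c)(A - B). -/
theorem fwd_last_of_spells (P : Threshold Λ D) (hu : ∑ d, P.u d ≠ 0) (hc0 : 0 < P.c)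
    (hc1 : P.c < 1) {os : ℕ → ℕ} {w : List Λ} {m : ℕ} (h : Spells os m w) (hos : os (m + 2) = 2) :
    P.c * (P.fwd os (m + 2) (.inr (.inl true)) + P.fwd os (m + 2) (.inr (.inl false))) <
      P.fwd os (m + 2) (.inr (.inl true)) ↔
    ∑ d, P.value w d * P.b d < ∑ d, P.value w d * P.a d := by
  rw [fwd_last_true_succ, fwd_last_false_succ, if_pos hos, if_pos hos,
    P.sum_fwd_mul h fun d => P.c * P.a d / P.bound,
    P.sum_fwd_mul h fun d => (1 - P.c) * P.b d / P.bound]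
  have hB : (0 : ℝ) < P.bound := by simp [bound]; positivity
  have hU : (0 : ℝ) < (∑ d, P.u d : ℕ) := by exact_mod_cast Nat.pos_of_ne_zero hu
  set V : ℝ := (∑ d, P.u d : ℕ) * (P.bound : ℝ) ^ m
  have hV : 0 < V := by positivity
  have hc0' : (0 : ℝ) < P.c := by exact_mod_cast hc0
  have hc1' : (0 : ℝ) < 1 - P.c := by
    have : (P.c : ℝ) < 1 := by exact_mod_cast hc1
    linarith
  have e1 : (∑ d, (P.value w d : ℝ) * (P.c * P.a d / P.bound)) / V =
      P.c * ((∑ d, P.value w d * P.a d : ℕ) / (P.bound * V)) := by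
    push_cast
    rw [Finset.sum_div, Finset.sum_div, Finset.mul_sum]
    exact Finset.sum_congr rfl fun d _ => by field_simp
  have e2 : (∑ d, (P.value w d : ℝ) * ((1 - P.c) * P.b d / P.bound)) / V =
      (1 - P.c) * ((∑ d, P.value w d * P.b d : ℕ) / (P.bound * V)) := by
    push_cast
    rw [Finset.sum_div, Finset.sum_div, Finset.mul_sum]
    exact Finset.sum_congr rfl fun d _ => by field_simp
  have e3 : ∑ d, P.value w d * P.b d < ∑ d, P.value w d * P.a d ↔
      ((∑ d, P.value w d * P.b d : ℕ) : ℝ) / (P.bound * V) <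
        (∑ d, P.value w d * P.a d : ℕ) / (P.bound * V) := by
    rw [div_lt_div_iff_of_pos_right (mul_pos hB hV), Nat.cast_lt]
  rw [e1, e2, e3]
  refine Iff.trans ?_ (mul_lt_mul_iff_right₀ (mul_pos hc0' hc1'))
  constructor <;> intro h <;> linarith

theorem exists_fwd_iff (P : Threshold Λ D) (hu : ∑ d, P.u d ≠ 0) (hc0 : 0 < P.c)
    (hc1 : P.c < 1) :
    (∃ os m, P.c * ∑ t, P.fwd os m t < P.fwd os m (.inr (.inl true))) ↔
    ∃ w : List Λ, ∑ d, P.value w d * P.b d < ∑ d, P.value w d * P.a d := by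
  have hsum : ∀ os m, os m = 2 → ∑ t, P.fwd os m t =
      P.fwd os m (.inr (.inl true)) + P.fwd os m (.inr (.inl false)) := by
    intro os m hos
    rw [Fintype.sum_sum_type, Fintype.sum_sum_type, Fintype.sum_bool, Fintype.sum_bool,
      P.fwd_eq_zero os m (t := .inr (.inr true)) (by simp [observe, hos]),
      P.fwd_eq_zero os m (t := .inr (.inr false)) (by simp [observe, hos]),
      Finset.sum_eq_zero fun p _ => P.fwd_eq_zero os m (t := .inl p)
        (by simp only [observe, hos]; omega)]
    ring
  constructor
  · rintro ⟨os, m, h⟩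
    -- The state satisfying `p` is observed as `2`; under any other last observation its mass is 0,
    -- which cannot exceed the left side.
    have hos : os m = 2 := by
      by_contra hos
      have hz : P.fwd os m (.inr (.inl true)) = 0 :=
        P.fwd_eq_zero os m (by simpa [observe] using Ne.symm hos)
      have hnn : ∀ m t, 0 ≤ P.fwd os m t := by
        intro m
        induction m with
        | zero => intro t; rw [fwd]; split_ifs <;> norm_num
        | succ m ih =>
          intro t
          rw [fwd]
          split_ifs
          · exact Finset.sum_nonneg fun s _ => mul_nonneg (ih s)
              (by exact_mod_cast P.prob_nonneg hu hc0 hc1 s t)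
          · exact le_rfl
      have : 0 ≤ P.c * ∑ t, P.fwd os m t :=
        mul_nonneg (by exact_mod_cast hc0.le) (Finset.sum_nonneg fun t _ => hnn m t)
      linarith
    rw [hsum os m hos] at h
    rcases m with _ | m
    · simp [fwd] at h
    by_cases hz : ∀ p, P.fwd os m (.inl p) = 0
    · simp [fwd_last_true_succ, fwd_last_false_succ, hz] at h
    push Not at hz
    obtain ⟨p, hp⟩ := hz
    rcases m with _ | m
    · exact absurd (P.fwd_inl_zero os p) hp
    obtain ⟨w, hw⟩ := P.exists_spells hp
    exact ⟨w, (P.fwd_last_of_spells hu hc0 hc1 hw hos).1 h⟩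
  · rintro ⟨w, h⟩
    -- The observations spell `w` at times `1, …, w.length + 1` and then announce a final state.
    let os : ℕ → ℕ
      | 0 => 0
      | j + 1 => if j ≤ w.length then 3 + Fintype.equivFin (Option Λ) (w.take j).getLast? else 2
    have hw : Spells os w.length w := ⟨rfl, rfl, fun j hj => if_pos hj⟩
    have hos : os (w.length + 2) = 2 := if_neg (by omega)
    refine ⟨os, w.length + 2, ?_⟩
    rw [hsum os (w.length + 2) hos]
    exact (P.fwd_last_of_spells hu hc0 hc1 hw hos).2 h

/-- The chain of a threshold problem satisfies `EF (Pr_i(p) > c)` if and only if the threshold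
problem has a solution. -/
theorem sprModels_chain_iff (P : Threshold Λ D) (hu : ∑ d, P.u d ≠ 0) (hc0 : 0 < P.c)
    (hc1 : P.c < 1) {n k : ℕ} (i : Fin n) (p : Fin k) :
    (P.chain hu hc0 hc1 n k).toPODTMC.SprModels
      (Formula.ex (Formula.eventually (Formula.probGt i (.atom p) P.c))) ↔
    ∃ w : List Λ, ∑ d, P.value w d * P.b d < ∑ d, P.value w d * P.a d := by
  classical
  have h0 : ∀ s, s ≠ (P.node hu hc0 hc1 n k).symm (.inr (.inr true)) →
      (P.chain hu hc0 hc1 n k).toPODTMC.init s = 0 := by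
    intro s hs
    change ((if P.node hu hc0 hc1 n k s = .inr (.inr true) then 1 else 0 : ℚ) : ℝ) = 0
    rw [if_neg fun h => hs ((Equiv.eq_symm_apply _).2 h)]
    simp
  refine ((P.chain hu hc0 hc1 n k).toPODTMC.sprModels_iff i p hc0.le _ h0).trans ?_
  rw [← P.exists_fwd_iff hu hc0 hc1]
  refine exists_congr fun os => exists_congr fun m => ?_
  simp only [forward_chain]
  have h1 : (Finset.univ.filter fun t => p ∈ (P.chain hu hc0 hc1 n k).toPODTMC.val t) =
      {(P.node hu hc0 hc1 n k).symm (.inr (.inl true))} := by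
    ext t
    rw [Finset.mem_filter, Finset.mem_singleton, Equiv.eq_symm_apply]
    change _ ∧ decide (P.node hu hc0 hc1 n k t = .inr (.inl true)) = true ↔ _
    simp
  rw [h1, Finset.sum_singleton, Equiv.apply_symm_apply, Equiv.sum_comp _ (P.fwd os m)]

end Threshold

end RegisterProgram

-- Computability of the reduction

namespace RegisterProgram

open PerfectRecall

theorem ratCode_div {a b : ℕ} (hb : 0 < b) (h : a.Coprime b) :
    FinitePODTMC.ratCode ((a : ℚ) / b) = (a, b) := by
  have hb' : (0 : ℤ) < b := by exact_mod_cast hb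
  have h1 := Rat.num_div_eq_of_coprime (a := a) hb' h
  have h2 := Rat.den_div_eq_of_coprime (a := a) hb' h
  push_cast at h1 h2
  rw [FinitePODTMC.ratCode, h1]
  refine Prod.ext (Int.toNat_natCast a) ?_
  exact_mod_cast h2

theorem primrec_pow (e : ℕ) : Primrec fun n : ℕ => n ^ e := by
  induction e with
  | zero => simpa using Primrec.const 1
  | succ e ih => exact (Primrec.nat_mul.comp ih Primrec.id).of_eq fun n => (pow_succ n e).symm

namespace Threshold

variable {Λ D : Type} [Fintype Λ] [Fintype D] [DecidableEq Λ] [DecidableEq D]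

/-- The starting vector enters only the row of the initial state; in particular `bound` does not
involve it. -/
theorem prob_eq_of_ne_start (P Q : Threshold Λ D) (hT : P.T = Q.T) (ha : P.a = Q.a) (hb : P.b = Q.b)
    (hc : P.c = Q.c) {s : Node Λ D} (hs : s ≠ .inr (.inr true)) (t : Node Λ D) :
    P.prob s t = Q.prob s t := by
  have hw : ∀ t, P.weight s t = Q.weight s t := by
    intro t
    rcases s with ⟨l, d⟩ | b | _ | _
    · rcases t with ⟨_ | l', d'⟩ | (_ | _) | b' <;> simp [weight, bound, hT, ha, hb, hc]
    · rfl
    · rfl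
    · exact absurd rfl hs
  simp only [prob, hw]

/-- The only entries that vary are n^e/(n+1)². They are already in lowest terms, as n and n+1 are
coprime, so numerator and denominator are explicit. -/
theorem primrec_ratCode_prob (T : Λ → D → D → ℕ) (u : ℕ → D → ℕ) (a b : D → ℕ) (c : ℚ)
    (hu : ∀ n, ∑ d, u n d = (n + 1) ^ 2)
    (hpow : ∀ d, (∀ n, u n d = 0) ∨ ∃ e, ∀ n, u n d = n ^ e) (s t : Node Λ D) :
    Primrec fun n => FinitePODTMC.ratCode ((⟨T, u n, a, b, c⟩ : Threshold Λ D).prob s t) := by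
  by_cases hs : s = .inr (.inr true)
  · subst hs
    have hu0 : ∀ n, ∑ d, u n d ≠ 0 := fun n => by rw [hu]; positivity
    have hprob : ∀ n, (⟨T, u n, a, b, c⟩ : Threshold Λ D).prob (.inr (.inr true)) t =
        (⟨T, u n, a, b, c⟩ : Threshold Λ D).weight (.inr (.inr true)) t := fun n => by
      rw [prob, sum_weight_start _ (hu0 n)]
      simp
    simp only [hprob]
    rcases t with ⟨_ | l, d⟩ | (_ | _) | t
    · have hw : ∀ n, (⟨T, u n, a, b, c⟩ : Threshold Λ D).weight (.inr (.inr true))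
          (.inl (none, d)) = (u n d : ℚ) / ((n + 1) ^ 2 : ℕ) := fun n => by
        rw [← hu]
        simp [weight]
      simp only [hw]
      rcases hpow d with h | ⟨e, h⟩
      · simp only [h, Nat.cast_zero, zero_div]
        exact Primrec.const _
      · refine (Primrec.pair (primrec_pow e)
          ((primrec_pow 2).comp Primrec.succ)).of_eq fun n => ?_
        rw [h, ratCode_div (by positivity)]
        exact Nat.Coprime.pow _ _ (by simp)
    all_goals exact Primrec.const (FinitePODTMC.ratCode 0)
  · exact (Primrec.const (FinitePODTMC.ratCode
      ((⟨T, u 0, a, b, c⟩ : Threshold Λ D).prob s t))).of_eq fun n =>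
        congrArg FinitePODTMC.ratCode
          (prob_eq_of_ne_start ⟨T, u 0, a, b, c⟩ ⟨T, u n, a, b, c⟩ rfl rfl rfl rfl hs t)

theorem primrec_encode_chain (T : Λ → D → D → ℕ) (u : ℕ → D → ℕ) (a b : D → ℕ) (c : ℚ)
    (hu : ∀ n, ∑ d, u n d = (n + 1) ^ 2)
    (hpow : ∀ d, (∀ n, u n d = 0) ∨ ∃ e, ∀ n, u n d = n ^ e) (hc0 : 0 < c) (hc1 : c < 1)
    (n k : ℕ) (hu0 : ∀ n, ∑ d, u n d ≠ 0) :
    Primrec fun m => ((⟨T, u m, a, b, c⟩ : Threshold Λ D).chain (hu0 m) hc0 hc1 n k).encode := by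
  have h : Primrec fun m => List.ofFn fun s => List.ofFn fun t =>
      FinitePODTMC.ratCode ((⟨T, u m, a, b, c⟩ : Threshold Λ D).prob
        ((Fintype.equivFin (Node Λ D)).symm s) ((Fintype.equivFin (Node Λ D)).symm t)) :=
    Primrec.list_ofFn fun s => Primrec.list_ofFn fun t =>
      primrec_ratCode_prob T u a b c hu hpow _ _
  -- Apart from the transition matrix, the code does not depend on the input, so it can be taken
  -- from input 0.
  let C := ((⟨T, u 0, a, b, c⟩ : Threshold Λ D).chain (hu0 0) hc0 hc1 n k).encode
  exact ((Primrec.const C.1).pair ((Primrec.const C.2.1).pair (h.pair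
    ((Primrec.const C.2.2.2.1).pair (Primrec.const C.2.2.2.2))))).of_eq fun m => rfl

end Threshold

end RegisterProgram

theorem theorem2 (n k : ℕ) (i : Fin n) (p : Fin k) (c : ℚ) (hc0 : 0 < c) (hc1 : c < 1) :
    ¬ PerfectRecall.DecidableProperty (fun M : PerfectRecall.FinitePODTMC n k =>
        M.toPODTMC.SprModels
          (PerfectRecall.Formula.ex (PerfectRecall.Formula.eventually
            (PerfectRecall.Formula.probGt i (PerfectRecall.Formula.atom p) c)))) := by
  classical
  rintro ⟨Q, hQ, hQM⟩
  -- One partial function covers the halting of all codes on input 0; thus the matrices are fixed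
  -- and a code enters only through the starting vector.
  have hf : Partrec fun m : ℕ => (Denumerable.ofNat Nat.Partrec.Code m).eval 0 :=
    Nat.Partrec.Code.eval_part.comp (Computable.ofNat _) (Computable.const 0)
  obtain ⟨Λ, D, _, _, T, u, a, b, hu, hpow, hT⟩ := RegisterProgram.exists_matrices hf
  have hu0 : ∀ n, ∑ d, u n d ≠ 0 := fun n => by rw [hu]; positivity
  have henc := RegisterProgram.Threshold.primrec_encode_chain T u a b c hu hpow hc0 hc1 n k hu0
  refine ComputablePred.halting_problem 0 (hQ.computable_of_manyOneReducible
    ⟨_, henc.to_comp.comp Computable.encode, fun e => ?_⟩)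
  rw [hQM]
  refine Iff.trans ?_ (RegisterProgram.Threshold.sprModels_chain_iff
    ⟨T, u (Encodable.encode e), a, b, c⟩ (hu0 _) hc0 hc1 i p).symm
  refine Iff.trans ?_ (hT (Encodable.encode e))
  rw [Denumerable.ofNat_encode]
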